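/- For integers $p,q\ge 0$, let $B'(p,q,p)$ be the graph on the $2p+q+2$ vertices $u,\,v,\,u_1,\dots,u_p,\,w_1,\dots,w_q,\,v_1,\dots,v_p$ whose edges are $uv$, all $uu_i$ and $vv_i$ $(1\le i\le p)$, and all $uw_j$ and $vw_j$ $(1\le j\le q)$. Then $B'(p,q,p)$ is determined by its Laplacian spectrum: every finite simple graph $H$ whose Laplacian matrix $L(H)=D(H)-A(H)$ (diagonal matrix of vertex degrees minus adjacency matrix) has the same eigenvalues, with multiplicities, as that of $B'(p,q,p)$ is isomorphic to $B'(p,q,p)$. -/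

import Mathlib

universe u v

/-- The Laplacian spectrum of a finite simple graph: the multiset of the roots, with multiplicity,
of the characteristic polynomial of its Laplacian matrix `D - A` (a real symmetric matrix, so all
the eigenvalues are real). -/
noncomputable def laplacianSpectrum {V : Type u} [Fintype V] (G : SimpleGraph V) : Multiset ℝ :=
  haveI := Classical.decEq V
  haveI := Classical.decRel G.Adj
  (G.lapMatrix ℝ).charpoly.roots

/-- Two finite simple graphs are `L`-cospectral if they have the same Laplacian spectrum. -/
def LCospectral {V : Type u} {W : Type v} [Fintype V] [Fintype W]
    (G : SimpleGraph V) (H : SimpleGraph W) : Prop :=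
  laplacianSpectrum G = laplacianSpectrum H

/-- A finite simple graph is determined by its Laplacian spectrum if every finite simple graph
that is `L`-cospectral with it is isomorphic to it. -/
def IsDLS {V : Type u} [Fintype V] (G : SimpleGraph V) : Prop :=
  ∀ (W : Type v) [Fintype W] (H : SimpleGraph W), LCospectral G H → Nonempty (G ≃g H)

/-- The `p + q + r + 2` vertices of a binary star graph: the two centres `u` (`false`) and `v`
(`true`), then the vertices `u₁, …, u_p`, then `w₁, …, w_q`, then `v₁, …, v_r`. -/
abbrev BinaryStarVertex (p q r : ℕ) : Type := Bool ⊕ (Fin p ⊕ (Fin q ⊕ Fin r))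

/-- The binary star graph `B(p,q,r)`: `u` is joined to all `u_i` and all `w_j`, and `v` is joined
to all `w_j` and all `v_k`; there are no other edges (`fromRel` symmetrizes the relation). -/
def binaryStar (p q r : ℕ) : SimpleGraph (BinaryStarVertex p q r) :=
  SimpleGraph.fromRel fun x y => match x, y with
    | .inl false, .inr (.inl _) => True
    | .inl false, .inr (.inr (.inl _)) => True
    | .inl true, .inr (.inr (.inl _)) => True
    | .inl true, .inr (.inr (.inr _)) => True
    | _, _ => False

/-- The binary star graph `B'(p,q,r)`: the graph `B(p,q,r)` together with the edge `uv`. -/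
def binaryStar' (p q r : ℕ) : SimpleGraph (BinaryStarVertex p q r) :=
  binaryStar p q r ⊔ SimpleGraph.edge (.inl false) (.inl true)

/-! ### Spectrum, orthogonal similarity and the quadratic form -/

open Matrix Finset

/-! After moving `H` to the same vertex set, cospectrality makes the two Laplacians orthogonally
similar, so an isometry carries one quadratic form to the other. Eigenvalue bounds are never stated
as such: each is an estimate of the form of `B'` on a subspace cut out by a few linear conditions,
pulled back along the isometry and tested on explicit vectors for `H`.

Write `N = p + q`. The kernel is one-dimensional, so `H` is connected. The largest eigenvalue is
below `N + 3`, so all degrees of `H` are at most `N + 1` (`degree_add_one_lt_of_lapForm_lt`). At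
most two eigenvalues exceed 2, which limits the product of three degree excesses over 2
(`degree_mul_le_of_lapForm_le`). The traces of `L`, `L ^ 2`, `L ^ 3` give the sum of the degrees, of
their squares, and of their cubes minus the ordered triangles.

For `p ≥ 1` these facts force two vertices of degree `N + 1` and all others of degree 1 or 2
(`exists_two_large_degree`). The cubes then give as many triangles as vertices of degree 2, and
double counting shows that each such vertex is joined to both large ones
(`adj_of_orderedTriangles`). Connectedness hangs the leaves on the large vertices, and counting
finishes.

For `p = 0` the degree sums are too weak for that argument. Instead all but one eigenvalue are at
least 2, so for `q ≥ 1` every degree is at least 2, and the first two degree sums suffice. -/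

theorem laplacianSpectrum_eq_roots {V : Type*} [Fintype V] [DecidableEq V] (G : SimpleGraph V)
    [DecidableRel G.Adj] : laplacianSpectrum G = (G.lapMatrix ℝ).charpoly.roots := by
  unfold laplacianSpectrum
  congr!

theorem laplacianSpectrum_card {V : Type*} [Fintype V] (G : SimpleGraph V) :
    Multiset.card (laplacianSpectrum G) = Fintype.card V := by
  classical
  rw [laplacianSpectrum_eq_roots, (G.isHermitian_lapMatrix ℝ).roots_charpoly_eq_eigenvalues]
  simp

theorem laplacianSpectrum_iso {V W : Type*} [Fintype V] [Fintype W] {G : SimpleGraph V}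
    {H : SimpleGraph W} (φ : G ≃g H) : laplacianSpectrum G = laplacianSpectrum H := by
  classical
  rw [laplacianSpectrum_eq_roots, laplacianSpectrum_eq_roots]
  have : H.lapMatrix ℝ = Matrix.reindex φ.toEquiv φ.toEquiv (G.lapMatrix ℝ) := by
    ext i j
    simp only [SimpleGraph.lapMatrix, SimpleGraph.degMatrix, Matrix.reindex_apply,
      Matrix.submatrix_apply, Matrix.sub_apply, Matrix.diagonal_apply, SimpleGraph.adjMatrix_apply]
    have h1 := φ.symm.map_adj_iff (v := i) (w := j)
    have h2 := φ.symm.degree_eq i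
    have h3 : φ.symm i = φ.symm j ↔ i = j := EmbeddingLike.apply_eq_iff_eq _
    change _ = (if φ.symm i = φ.symm j then (G.degree (φ.symm i) : ℝ) else 0) -
      (if G.Adj (φ.symm i) (φ.symm j) then 1 else 0)
    simp only [h1, h2, h3]
  rw [this, Matrix.charpoly_reindex]

/-- Real symmetric matrices with the same characteristic polynomial are orthogonally similar. -/
theorem Matrix.IsHermitian.exists_orthogonal_conj {V : Type*} [Fintype V] [DecidableEq V]
    {A B : Matrix V V ℝ} (hA : A.IsHermitian) (hB : B.IsHermitian)
    (h : A.charpoly = B.charpoly) :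
    ∃ Q : Matrix V V ℝ, Qᵀ * Q = 1 ∧ Q * Qᵀ = 1 ∧ B = Q * A * Qᵀ := by
  have he := (hA.eigenvalues_eq_eigenvalues_iff hB).2 h
  have h1 := hA.spectral_theorem
  have h2 := hB.spectral_theorem
  rw [Unitary.conjStarAlgAut_apply] at h1 h2
  rw [he] at h1
  set D : Matrix V V ℝ := diagonal (RCLike.ofReal ∘ hB.eigenvalues)
  have u1 : star (hA.eigenvectorUnitary : Matrix V V ℝ) * hA.eigenvectorUnitary = 1 :=
    Unitary.coe_star_mul_self _
  have u2 : (hA.eigenvectorUnitary : Matrix V V ℝ) * star (hA.eigenvectorUnitary : Matrix V V ℝ) = 1 :=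
    Unitary.coe_mul_star_self _
  have v1 : star (hB.eigenvectorUnitary : Matrix V V ℝ) * hB.eigenvectorUnitary = 1 :=
    Unitary.coe_star_mul_self _
  have v2 : (hB.eigenvectorUnitary : Matrix V V ℝ) * star (hB.eigenvectorUnitary : Matrix V V ℝ) = 1 :=
    Unitary.coe_mul_star_self _
  generalize (hA.eigenvectorUnitary : Matrix V V ℝ) = S at *
  generalize (hB.eigenvectorUnitary : Matrix V V ℝ) = R at *
  have st : ∀ M : Matrix V V ℝ, star M = Mᵀ := fun M => by
    rw [Matrix.star_eq_conjTranspose, Matrix.conjTranspose_eq_transpose_of_trivial]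
  simp only [st] at *
  have key : ∀ M P : Matrix V V ℝ, Sᵀ * S = 1 → M * Sᵀ * (S * P) = M * P := fun M P hS => by
    rw [Matrix.mul_assoc, ← Matrix.mul_assoc Sᵀ, hS, Matrix.one_mul]
  -- Both matrices are diagonalised to the same `D`, so composing one eigenbasis change with the
  -- inverse of the other conjugates `A` to `B`.
  refine ⟨R * Sᵀ, ?_, ?_, ?_⟩
  · rw [transpose_mul, transpose_transpose, Matrix.mul_assoc, ← Matrix.mul_assoc Rᵀ, v1,
      Matrix.one_mul, u2]
  · rw [transpose_mul, transpose_transpose, key _ _ u1, v2]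
  · rw [transpose_mul, transpose_transpose, h2, h1]
    simp only [Matrix.mul_assoc]
    rw [← Matrix.mul_assoc Sᵀ S (Rᵀ), u1, Matrix.one_mul, ← Matrix.mul_assoc Sᵀ S, u1,
      Matrix.one_mul]

/-- Twice the quadratic form of the Laplacian matrix. -/
def SimpleGraph.lapForm {V : Type*} [Fintype V] (G : SimpleGraph V) [DecidableRel G.Adj]
    (x : V → ℝ) : ℝ := ∑ i, ∑ j, if G.Adj i j then (x i - x j) ^ 2 else 0

theorem SimpleGraph.lapForm_eq {V : Type*} [Fintype V] [DecidableEq V] (G : SimpleGraph V)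
    [DecidableRel G.Adj] (x : V → ℝ) : G.lapForm x = 2 * (x ⬝ᵥ (G.lapMatrix ℝ *ᵥ x)) := by
  have := G.lapMatrix_toLinearMap₂' ℝ x
  rw [toLinearMap₂'_apply'] at this
  rw [this, SimpleGraph.lapForm]
  ring

/-- `L`-cospectral graphs have the same quadratic form up to an isometry. -/
theorem SimpleGraph.exists_isometry_of_spectrum_eq {V : Type*} [Fintype V] [DecidableEq V]
    {G H : SimpleGraph V} [DecidableRel G.Adj] [DecidableRel H.Adj]
    (h : laplacianSpectrum G = laplacianSpectrum H) :
    (∃ T : (V → ℝ) →ₗ[ℝ] (V → ℝ), ∀ x, G.lapForm (T x) = H.lapForm x ∧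
      ∑ i, T x i ^ 2 = ∑ i, x i ^ 2) ∧
    ∀ k, (G.lapMatrix ℝ ^ k).trace = (H.lapMatrix ℝ ^ k).trace := by
  rw [laplacianSpectrum_eq_roots, laplacianSpectrum_eq_roots] at h
  have hG := G.isHermitian_lapMatrix ℝ
  have hH := H.isHermitian_lapMatrix ℝ
  have hc : (G.lapMatrix ℝ).charpoly = (H.lapMatrix ℝ).charpoly := by
    rw [hG.splits_charpoly.eq_prod_roots_of_monic (charpoly_monic _),
      hH.splits_charpoly.eq_prod_roots_of_monic (charpoly_monic _), h]
  obtain ⟨Q, h1, h2, h3⟩ := hG.exists_orthogonal_conj hH hc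
  refine ⟨⟨Qᵀ.mulVecLin, fun x => ⟨?_, ?_⟩⟩, fun k => ?_⟩
  · rw [lapForm_eq, lapForm_eq, h3, mulVecLin_apply, ← Matrix.mulVec_mulVec,
      ← Matrix.mulVec_mulVec, Matrix.dotProduct_mulVec _ Q, ← Matrix.mulVec_transpose]
  · have : ∀ y : V → ℝ, ∑ i, y i ^ 2 = y ⬝ᵥ y := fun y => by simp [dotProduct, sq]
    rw [this, this, mulVecLin_apply, Matrix.dotProduct_mulVec, ← Matrix.mulVec_transpose,
      transpose_transpose, Matrix.mulVec_mulVec, h2, Matrix.one_mulVec]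
  · have hk : H.lapMatrix ℝ ^ k = Q * G.lapMatrix ℝ ^ k * Qᵀ := by
      induction k with
      | zero => simp [h2]
      | succ k ih =>
        rw [pow_succ, ih, pow_succ]
        rw [h3]
        simp only [Matrix.mul_assoc]
        rw [← Matrix.mul_assoc Qᵀ Q, h1, Matrix.one_mul]
    rw [hk, Matrix.trace_mul_comm, ← Matrix.mul_assoc, h1, Matrix.one_mul]

theorem SimpleGraph.eq_of_lapForm_nonpos {V : Type*} [Fintype V] {G : SimpleGraph V}
    [DecidableRel G.Adj] {x : V → ℝ} (h : G.lapForm x ≤ 0) {i j : V} (hij : G.Adj i j) :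
    x i = x j := by
  have h0 : ∀ i j, 0 ≤ if G.Adj i j then (x i - x j) ^ 2 else 0 := fun i j => by
    split_ifs <;> positivity
  have h1 : G.lapForm x = 0 := le_antisymm h (sum_nonneg fun i _ => sum_nonneg fun j _ => h0 i j)
  have h2 := (sum_eq_zero_iff_of_nonneg fun i _ => sum_nonneg fun j _ => h0 i j).1 h1 i (mem_univ _)
  have h3 := (sum_eq_zero_iff_of_nonneg fun j _ => h0 i j).1 h2 j (mem_univ _)
  rw [if_pos hij] at h3
  nlinarith

/-! ### Adjacency, degrees, triangles and form estimates for `B'` -/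

section binaryStar
variable {p q r : ℕ}

theorem binaryStar'_adj_inl_inl {b c : Bool} :
    (binaryStar' p q r).Adj (.inl b) (.inl c) ↔ b ≠ c := by
  cases b <;> cases c <;> simp [binaryStar', binaryStar, SimpleGraph.edge_adj]

theorem binaryStar'_adj_inl_left {b : Bool} {i : Fin p} :
    (binaryStar' p q r).Adj (.inl b) (.inr (.inl i)) ↔ b = false := by
  cases b <;> simp [binaryStar', binaryStar, SimpleGraph.edge_adj]

theorem binaryStar'_adj_inl_mid {b : Bool} {i : Fin q} :
    (binaryStar' p q r).Adj (.inl b) (.inr (.inr (.inl i))) := by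
  cases b <;> simp [binaryStar', binaryStar, SimpleGraph.edge_adj]

theorem binaryStar'_adj_inl_right {b : Bool} {i : Fin r} :
    (binaryStar' p q r).Adj (.inl b) (.inr (.inr (.inr i))) ↔ b = true := by
  cases b <;> simp [binaryStar', binaryStar, SimpleGraph.edge_adj]

theorem not_binaryStar'_adj_inr_inr {x y : Fin p ⊕ (Fin q ⊕ Fin r)} :
    ¬ (binaryStar' p q r).Adj (.inr x) (.inr y) := by
  rcases x with x | x | x <;> rcases y with y | y | y <;>
    simp [binaryStar', binaryStar, SimpleGraph.edge_adj]

theorem binaryStar'_adj_inr_inl {x : Fin p ⊕ (Fin q ⊕ Fin r)} {b : Bool} :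
    (binaryStar' p q r).Adj (.inr x) (.inl b) ↔ (binaryStar' p q r).Adj (.inl b) (.inr x) :=
  SimpleGraph.adj_comm ..

variable [DecidableRel (binaryStar' p q r).Adj]

/-- The degrees of `B'(p,q,r)`. -/
theorem binaryStar'_degree_inl_false :
    (binaryStar' p q r).degree (.inl false) = p + q + 1 := by
  have := (binaryStar' p q r).degree_eq_sum_if_adj (R := ℕ) (.inl false)
  simp only [Fintype.sum_sum_type, Fintype.sum_bool, binaryStar'_adj_inl_inl, binaryStar'_adj_inl_left,
    binaryStar'_adj_inl_mid, binaryStar'_adj_inl_right] at this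
  simp at this
  omega

theorem binaryStar'_degree_inl_true :
    (binaryStar' p q r).degree (.inl true) = q + r + 1 := by
  have := (binaryStar' p q r).degree_eq_sum_if_adj (R := ℕ) (.inl true)
  simp only [Fintype.sum_sum_type, Fintype.sum_bool, binaryStar'_adj_inl_inl, binaryStar'_adj_inl_left,
    binaryStar'_adj_inl_mid, binaryStar'_adj_inl_right] at this
  simp at this
  omega

theorem binaryStar'_degree_left (i : Fin p) :
    (binaryStar' p q r).degree (.inr (.inl i)) = 1 := by
  have := (binaryStar' p q r).degree_eq_sum_if_adj (R := ℕ) (.inr (.inl i))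
  simp only [Fintype.sum_sum_type, Fintype.sum_bool, binaryStar'_adj_inr_inl, binaryStar'_adj_inl_left,
    not_binaryStar'_adj_inr_inr] at this
  simp at this
  omega

theorem binaryStar'_degree_mid (i : Fin q) :
    (binaryStar' p q r).degree (.inr (.inr (.inl i))) = 2 := by
  have := (binaryStar' p q r).degree_eq_sum_if_adj (R := ℕ) (.inr (.inr (.inl i)))
  simp only [Fintype.sum_sum_type, Fintype.sum_bool, binaryStar'_adj_inr_inl, binaryStar'_adj_inl_mid,
    not_binaryStar'_adj_inr_inr] at this
  simp at this
  omega

theorem binaryStar'_degree_right (i : Fin r) :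
    (binaryStar' p q r).degree (.inr (.inr (.inr i))) = 1 := by
  have := (binaryStar' p q r).degree_eq_sum_if_adj (R := ℕ) (.inr (.inr (.inr i)))
  simp only [Fintype.sum_sum_type, Fintype.sum_bool, binaryStar'_adj_inr_inl, binaryStar'_adj_inl_right,
    not_binaryStar'_adj_inr_inr] at this
  simp at this
  omega

/-- Sums over the vertices of `B'(p,q,r)` of a function of the degree. -/
theorem binaryStar'_sum_degree (f : ℕ → ℤ) :
    ∑ x, f ((binaryStar' p q r).degree x) =
      f (p + q + 1) + f (q + r + 1) + (p + r) * f 1 + q * f 2 := by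
  simp only [Fintype.sum_sum_type, Fintype.sum_bool, binaryStar'_degree_inl_false,
    binaryStar'_degree_inl_true, binaryStar'_degree_left, binaryStar'_degree_mid,
    binaryStar'_degree_right, sum_const, card_univ, Fintype.card_fin, nsmul_eq_mul]
  ring

theorem binaryStar'_lapForm (x : BinaryStarVertex p q r → ℝ) :
    (binaryStar' p q r).lapForm x = 2 * ((x (.inl false) - x (.inl true)) ^ 2 +
      ∑ i, (x (.inl false) - x (.inr (.inl i))) ^ 2 +
      ∑ i, (x (.inl false) - x (.inr (.inr (.inl i)))) ^ 2 +
      ∑ i, (x (.inl true) - x (.inr (.inr (.inl i)))) ^ 2 +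
      ∑ i, (x (.inl true) - x (.inr (.inr (.inr i)))) ^ 2) := by
  have h : ∀ a b : ℝ, (a - b) ^ 2 = (b - a) ^ 2 := fun a b => by ring
  simp only [SimpleGraph.lapForm, Fintype.sum_sum_type, Fintype.sum_bool,
    binaryStar'_adj_inr_inl, binaryStar'_adj_inl_mid, binaryStar'_adj_inl_right,
    binaryStar'_adj_inl_left, binaryStar'_adj_inl_inl, not_binaryStar'_adj_inr_inr]
  simp only [ne_eq, not_true_eq_false, if_false, if_true, reduceCtorEq, not_false_eq_true,
    sum_const_zero, sum_add_distrib, add_zero, zero_add]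
  rw [h (x (.inl true)) (x (.inl false))]
  simp only [fun i => h (x (.inr i)) (x (.inl true)), fun i => h (x (.inr i)) (x (.inl false))]
  ring

theorem binaryStar'_sum_triangles :
    ∑ x, ∑ y, ∑ z, (if (binaryStar' p q r).Adj x y ∧ (binaryStar' p q r).Adj y z ∧
      (binaryStar' p q r).Adj z x then (1 : ℤ) else 0) = 6 * q := by
  simp only [Fintype.sum_sum_type, Fintype.sum_bool,
    binaryStar'_adj_inr_inl, binaryStar'_adj_inl_mid, binaryStar'_adj_inl_right,
    binaryStar'_adj_inl_left, binaryStar'_adj_inl_inl, not_binaryStar'_adj_inr_inr]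
  simp
  ring

/-- Maximising over each non-central coordinate by completing the square leaves a form in the two
central values, whose deficit is a positive multiple of `a ^ 2 + b ^ 2` plus a nonnegative multiple
of `(a + b) ^ 2`. Strictness matters: it later gives degree at most `p + q + 1` rather than `p + q +
2`. -/
theorem binaryStar'_lapForm_lt [DecidableRel (binaryStar' p q p).Adj]
    (x : BinaryStarVertex p q p → ℝ) (hx : x ≠ 0) :
    (binaryStar' p q p).lapForm x < 2 * (p + q + 3) * ∑ i, x i ^ 2 := by
  rw [binaryStar'_lapForm]
  simp only [Fintype.sum_sum_type, Fintype.sum_bool]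
  set a := x (.inl false) with ha
  set b := x (.inl true) with hb
  have hp : (0 : ℝ) ≤ p := p.cast_nonneg
  have hq : (0 : ℝ) ≤ q := q.cast_nonneg
  -- With `λ = p + q + 3`, the denominators here and in `key2` are `λ - 1` and `λ - 2`, for vertices
  -- with one and two central neighbours.
  have key : ∀ s t : ℝ, (s - t) ^ 2 ≤ (p + q + 3) * t ^ 2 + (1 + 1 / (p + q + 2)) * s ^ 2 := by
    intro s t
    have : (p + q + 3) * t ^ 2 + (1 + 1 / (p + q + 2)) * s ^ 2 - (s - t) ^ 2 =
      ((p + q + 2) * t + s) ^ 2 / (p + q + 2) := by field_simp; ring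
    have : 0 ≤ ((p + q + 2) * t + s) ^ 2 / (p + q + 2 : ℝ) := by positivity
    linarith
  have key2 : ∀ t : ℝ, (a - t) ^ 2 + (b - t) ^ 2 ≤
      (p + q + 3) * t ^ 2 + (a ^ 2 + b ^ 2 + (a + b) ^ 2 / (p + q + 1)) := by
    intro t
    have : (p + q + 3) * t ^ 2 + (a ^ 2 + b ^ 2 + (a + b) ^ 2 / (p + q + 1)) -
      ((a - t) ^ 2 + (b - t) ^ 2) = ((p + q + 1) * t + (a + b)) ^ 2 / (p + q + 1) := by
      field_simp; ring
    have : 0 ≤ ((p + q + 1) * t + (a + b)) ^ 2 / (p + q + 1 : ℝ) := by positivity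
    linarith
  have h1 : ∑ i, (a - x (.inr (.inl i))) ^ 2 ≤
      (p + q + 3) * ∑ i, x (.inr (.inl i)) ^ 2 + p * ((1 + 1 / (p + q + 2)) * a ^ 2) := by
    refine (sum_le_sum fun i _ => key a (x (.inr (.inl i)))).trans_eq ?_
    simp [sum_add_distrib, mul_sum]
  have h2 : ∑ i, (b - x (.inr (.inr (.inr i)))) ^ 2 ≤
      (p + q + 3) * ∑ i, x (.inr (.inr (.inr i))) ^ 2 + p * ((1 + 1 / (p + q + 2)) * b ^ 2) := by
    refine (sum_le_sum fun i _ => key b (x (.inr (.inr (.inr i))))).trans_eq ?_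
    simp [sum_add_distrib, mul_sum]
  have h3 : ∑ i, (a - x (.inr (.inr (.inl i)))) ^ 2 + ∑ i, (b - x (.inr (.inr (.inl i)))) ^ 2 ≤
      (p + q + 3) * ∑ i, x (.inr (.inr (.inl i))) ^ 2 +
        q * (a ^ 2 + b ^ 2 + (a + b) ^ 2 / (p + q + 1)) := by
    rw [← sum_add_distrib]
    refine (sum_le_sum fun i _ => key2 (x (.inr (.inr (.inl i))))).trans_eq ?_
    simp only [sum_add_distrib, mul_sum, sum_const, card_univ, Fintype.card_fin, nsmul_eq_mul]
    ring
  have e1 : (p : ℝ) / (p + q + 2) < 1 := by rw [div_lt_one (by positivity)]; linarith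
  have e2 : (q : ℝ) / (p + q + 1) < 1 := by rw [div_lt_one (by positivity)]; linarith
  have slack : (a - b) ^ 2 + p * ((1 + 1 / (p + q + 2)) * a ^ 2) +
      p * ((1 + 1 / (p + q + 2)) * b ^ 2) + q * (a ^ 2 + b ^ 2 + (a + b) ^ 2 / (p + q + 1)) =
      (p + q + 3) * (a ^ 2 + b ^ 2) - (1 - p / (p + q + 2)) * (a ^ 2 + b ^ 2)
        - (1 - q / (p + q + 1)) * (a + b) ^ 2 := by
    field_simp; ring
  have n1 : 0 ≤ (1 - q / (p + q + 1)) * (a + b) ^ 2 :=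
    mul_nonneg (by linarith) (sq_nonneg _)
  by_cases hab : a = 0 ∧ b = 0
  · obtain ⟨ha0, hb0⟩ := hab
    have hpos : 0 < ∑ i, x i ^ 2 := by
      obtain ⟨i, hi⟩ := Function.ne_iff.1 hx
      exact sum_pos' (fun i _ => sq_nonneg _) ⟨i, mem_univ _, by
        have : x i ≠ 0 := hi
        positivity⟩
    simp only [Fintype.sum_sum_type, Fintype.sum_bool, ← ha, ← hb, ha0, hb0] at hpos
    simp only [ha0, hb0, zero_sub, neg_sq]
    have s1 : 0 ≤ ∑ i, x (.inr (.inl i)) ^ 2 := sum_nonneg fun i _ => sq_nonneg _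
    have s2 : 0 ≤ ∑ i, x (.inr (.inr (.inr i))) ^ 2 := sum_nonneg fun i _ => sq_nonneg _
    have s3 : 0 ≤ ∑ i, x (.inr (.inr (.inl i))) ^ 2 := sum_nonneg fun i _ => sq_nonneg _
    nlinarith
  · have hab2 : 0 < a ^ 2 + b ^ 2 := by
      by_contra hcon
      exact hab ⟨by nlinarith [sq_nonneg a, sq_nonneg b], by nlinarith [sq_nonneg a, sq_nonneg b]⟩
    have n2 : 0 < (1 - p / (p + q + 2)) * (a ^ 2 + b ^ 2) := mul_pos (by linarith) hab2
    linarith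

/-- Deleting the centres leaves a diagonal form with entries 1 and 2. Two linear conditions thus
suffice, so at most two eigenvalues exceed 2; the 4 reflects that `lapForm` is twice the quadratic
form. -/
theorem binaryStar'_lapForm_le (x : BinaryStarVertex p q r → ℝ) (hu : x (.inl false) = 0)
    (hv : x (.inl true) = 0) :
    (binaryStar' p q r).lapForm x ≤ 4 * ∑ i, x i ^ 2 := by
  rw [binaryStar'_lapForm, hu, hv]
  simp only [Fintype.sum_sum_type, Fintype.sum_bool, hu, hv, zero_sub, neg_sq]
  have h1 : 0 ≤ ∑ i, x (.inr (.inl i)) ^ 2 := sum_nonneg fun i _ => sq_nonneg _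
  have h2 : 0 ≤ ∑ i, x (.inr (.inr (.inr i))) ^ 2 := sum_nonneg fun i _ => sq_nonneg _
  linarith

/-- On the hyperplane where the central values are opposite, the cross terms cancel. Hence all but
one eigenvalue are at least 2. -/
theorem le_binaryStar'_lapForm (x : BinaryStarVertex 0 q 0 → ℝ)
    [DecidableRel (binaryStar' 0 q 0).Adj] (hx : x (.inl false) + x (.inl true) = 0) :
    4 * ∑ i, x i ^ 2 ≤ (binaryStar' 0 q 0).lapForm x := by
  have hu : x (.inl true) = - x (.inl false) := by linarith
  rw [binaryStar'_lapForm, hu]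
  simp only [Fintype.sum_sum_type, Fintype.sum_bool, hu, univ_eq_empty, sum_empty]
  have : ∑ i, (x (.inl false) - x (.inr (.inr (.inl i)))) ^ 2 +
      ∑ i, (- x (.inl false) - x (.inr (.inr (.inl i)))) ^ 2 =
      2 * q * x (.inl false) ^ 2 + 2 * ∑ i, x (.inr (.inr (.inl i))) ^ 2 := by
    rw [← sum_add_distrib, mul_sum]
    rw [show 2 * q * x (.inl false) ^ 2 = ∑ i : Fin q, 2 * x (.inl false) ^ 2 by simp; ring]
    rw [← sum_add_distrib]
    exact sum_congr rfl fun i _ => by ring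
  have : 0 ≤ (q : ℝ) * x (.inl false) ^ 2 := by positivity
  linarith

theorem binaryStar'_eq_zero_of_lapForm_nonpos {x : BinaryStarVertex p q r → ℝ}
    (h : (binaryStar' p q r).lapForm x ≤ 0) (hx : x (.inl false) = 0) : x = 0 := by
  have hv : x (.inl true) = 0 := by
    rw [← hx]
    exact SimpleGraph.eq_of_lapForm_nonpos h (binaryStar'_adj_inl_inl.2 (by simp))
  funext i
  rcases i with (_ | _) | i | i | i
  · exact hx
  · exact hv
  · exact (SimpleGraph.eq_of_lapForm_nonpos h (binaryStar'_adj_inl_left.2 rfl)).symm.trans hx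
  · exact (SimpleGraph.eq_of_lapForm_nonpos h (binaryStar'_adj_inl_mid (b := false))).symm.trans hx
  · exact (SimpleGraph.eq_of_lapForm_nonpos h (binaryStar'_adj_inl_right.2 rfl)).symm.trans hv

end binaryStar

/-! ### Dimension counts and connectedness -/

/-- This is the min-max principle in the form used throughout: among more test vectors than linear
conditions, some nontrivial combination meets all the conditions. -/
theorem LinearMap.exists_sum_smul_map_eq_zero {V E : Type*} [AddCommGroup E] [Module ℝ E]
    [FiniteDimensional ℝ E] (F : (V → ℝ) →ₗ[ℝ] E) {k : ℕ} (h : Module.finrank ℝ E < k)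
    (s : Fin k → V → ℝ) : ∃ c : Fin k → ℝ, c ≠ 0 ∧ F (∑ i, c i • s i) = 0 := by
  have := LinearMap.ker_ne_bot_of_finrank_lt (f := F ∘ₗ Fintype.linearCombination ℝ s)
    (by simpa using h)
  obtain ⟨c, hc, hc0⟩ := (Submodule.ne_bot_iff _).1 this
  refine ⟨c, hc0, ?_⟩
  simpa [Fintype.linearCombination_apply] using hc

/-- If the kernel of the Laplacian is at most one-dimensional, then the graph is connected. -/
theorem SimpleGraph.exists_adj_of_lapForm_ker {V : Type*} [Fintype V] {G : SimpleGraph V}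
    [DecidableRel G.Adj] {f : (V → ℝ) →ₗ[ℝ] ℝ}
    (h : ∀ x, f x = 0 → G.lapForm x ≤ 0 → x = 0) (S : Set V) {s t : V} (hs : s ∈ S)
    (ht : t ∉ S) : ∃ i ∈ S, ∃ j ∉ S, G.Adj i j := by
  classical
  by_contra! hcon
  -- With no edge leaving `S`, the indicators of `S` and of its complement both lie in the kernel of
  -- the Laplacian, which would then be two-dimensional.
  obtain ⟨c, hc, hfc⟩ := f.exists_sum_smul_map_eq_zero (k := 2) (by simp)
    ![fun i => if i ∈ S then 1 else 0, fun i => if i ∈ S then 0 else 1]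
  rw [Fin.sum_univ_two] at hfc
  have h0 := h _ hfc (le_of_eq ?_)
  · have h1 := congrFun h0 s
    have h2 := congrFun h0 t
    simp [hs] at h1
    simp [ht] at h2
    exact hc (funext fun i => by fin_cases i <;> simp [h1, h2])
  · refine sum_eq_zero fun i _ => sum_eq_zero fun j _ => ?_
    split_ifs with hij
    · by_cases hi : i ∈ S <;> by_cases hj : j ∈ S
      · simp [hi, hj]
      · exact absurd hij (hcon i hi j hj)
      · exact absurd hij.symm (hcon j hj i hi)
      · simp [hi, hj]
    · rfl

/-! ### Traces of powers and degree bounds from eigenvalues -/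

section lapForm
variable {V : Type*} [Fintype V] [DecidableEq V] {G H : SimpleGraph V} [DecidableRel G.Adj]
  [DecidableRel H.Adj]

namespace SimpleGraph

/-- The number of ordered triangles of a graph. -/
def orderedTriangles (G : SimpleGraph V) [DecidableRel G.Adj] : ℤ :=
  ∑ x, ∑ y, ∑ z, if G.Adj x y ∧ G.Adj y z ∧ G.Adj z x then 1 else 0

theorem trace_lapMatrix : (G.lapMatrix ℝ).trace = ∑ x, (G.degree x : ℝ) := by
  simp [lapMatrix, degMatrix, trace_sub]

theorem trace_diagonal_mul_adjMatrix (d : V → ℝ) : (diagonal d * G.adjMatrix ℝ).trace = 0 := by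
  simp only [trace, Matrix.diag_apply, diagonal_mul, adjMatrix_apply]
  simp

theorem trace_diagonal_mul_adjMatrix_sq (d : V → ℝ) :
    (diagonal d * (G.adjMatrix ℝ * G.adjMatrix ℝ)).trace = ∑ x, d x * G.degree x := by
  simp only [trace, Matrix.diag_apply, diagonal_mul, adjMatrix_mul_self_apply_self]

theorem trace_lapMatrix_sq :
    (G.lapMatrix ℝ ^ 2).trace = ∑ x, ((G.degree x : ℝ) ^ 2 + G.degree x) := by
  have h : G.lapMatrix ℝ ^ 2 = G.degMatrix ℝ * G.degMatrix ℝ - G.degMatrix ℝ * G.adjMatrix ℝ -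
      G.adjMatrix ℝ * G.degMatrix ℝ + G.adjMatrix ℝ * G.adjMatrix ℝ := by
    rw [lapMatrix]; noncomm_ring
  have h1 : (G.adjMatrix ℝ * G.adjMatrix ℝ).trace = ∑ x, (G.degree x : ℝ) := by
    simp only [trace, Matrix.diag_apply, adjMatrix_mul_self_apply_self]
  rw [h, trace_add, trace_sub, trace_sub, trace_mul_comm (G.adjMatrix ℝ) (G.degMatrix ℝ), h1,
    degMatrix, trace_diagonal_mul_adjMatrix, diagonal_mul_diagonal, trace_diagonal,
    sum_add_distrib]
  simp [sq]

/-- In the expansion of `(D - A) ^ 3`, terms with one `A` are traceless, the three with two `A` each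
contribute the sum of squared degrees, and `A ^ 3` counts ordered triangles. -/
theorem trace_lapMatrix_cube : (G.lapMatrix ℝ ^ 3).trace =
    ∑ x, ((G.degree x : ℝ) ^ 3 + 3 * (G.degree x : ℝ) ^ 2) - G.orderedTriangles := by
  have h : G.lapMatrix ℝ ^ 3 = G.degMatrix ℝ * (G.degMatrix ℝ * G.degMatrix ℝ)
      - (G.degMatrix ℝ * G.degMatrix ℝ) * G.adjMatrix ℝ
      - (G.degMatrix ℝ * G.adjMatrix ℝ) * G.degMatrix ℝ
      - G.adjMatrix ℝ * (G.degMatrix ℝ * G.degMatrix ℝ)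
      + G.degMatrix ℝ * (G.adjMatrix ℝ * G.adjMatrix ℝ)
      + (G.adjMatrix ℝ * G.degMatrix ℝ) * G.adjMatrix ℝ
      + (G.adjMatrix ℝ * G.adjMatrix ℝ) * G.degMatrix ℝ
      - G.adjMatrix ℝ * (G.adjMatrix ℝ * G.adjMatrix ℝ) := by
    rw [lapMatrix]; noncomm_ring
  have h1 : (G.adjMatrix ℝ * (G.adjMatrix ℝ * G.adjMatrix ℝ)).trace = G.orderedTriangles := by
    simp only [trace, Matrix.diag_apply, mul_apply, orderedTriangles, adjMatrix_apply, mul_sum]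
    push_cast
    refine sum_congr rfl fun x _ => sum_congr rfl fun y _ => sum_congr rfl fun z _ => ?_
    split_ifs <;> simp_all
  have h2 : (G.degMatrix ℝ * G.adjMatrix ℝ * G.degMatrix ℝ).trace =
      (G.degMatrix ℝ * G.degMatrix ℝ * G.adjMatrix ℝ).trace := by
    rw [trace_mul_comm, Matrix.mul_assoc]
  have h3 : (G.adjMatrix ℝ * G.degMatrix ℝ * G.adjMatrix ℝ).trace =
      (G.degMatrix ℝ * (G.adjMatrix ℝ * G.adjMatrix ℝ)).trace := by
    rw [Matrix.mul_assoc, trace_mul_comm, Matrix.mul_assoc]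
  rw [h]
  simp only [trace_add, trace_sub]
  rw [h1, h2, h3, trace_mul_comm (G.adjMatrix ℝ) (G.degMatrix ℝ * G.degMatrix ℝ),
    trace_mul_comm (G.adjMatrix ℝ * G.adjMatrix ℝ) (G.degMatrix ℝ), degMatrix,
    trace_diagonal_mul_adjMatrix_sq, diagonal_mul_diagonal, trace_diagonal_mul_adjMatrix,
    diagonal_mul_diagonal, trace_diagonal, sum_add_distrib, ← mul_sum]
  simp only [pow_succ, pow_zero, one_mul, mul_assoc]
  ring

theorem sum_degree_eq_of_trace
    (h : ∀ k, (G.lapMatrix ℝ ^ k).trace = (H.lapMatrix ℝ ^ k).trace) :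
    ∑ x, (G.degree x : ℤ) = ∑ x, (H.degree x : ℤ) := by
  have h1 := h 1
  rw [pow_one, pow_one, trace_lapMatrix, trace_lapMatrix] at h1
  exact_mod_cast h1

theorem sum_degree_sq_eq_of_trace
    (h : ∀ k, (G.lapMatrix ℝ ^ k).trace = (H.lapMatrix ℝ ^ k).trace) :
    ∑ x, (G.degree x : ℤ) ^ 2 = ∑ x, (H.degree x : ℤ) ^ 2 := by
  have h1 := sum_degree_eq_of_trace h
  have h2 := h 2
  rw [trace_lapMatrix_sq, trace_lapMatrix_sq] at h2
  have h3 : ∑ x, ((G.degree x : ℤ) ^ 2 + G.degree x) = ∑ x, ((H.degree x : ℤ) ^ 2 + H.degree x) := by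
    exact_mod_cast h2
  simp only [sum_add_distrib] at h3
  linarith

theorem sum_degree_cube_eq_of_trace
    (h : ∀ k, (G.lapMatrix ℝ ^ k).trace = (H.lapMatrix ℝ ^ k).trace) :
    ∑ x, (G.degree x : ℤ) ^ 3 - G.orderedTriangles =
      ∑ x, (H.degree x : ℤ) ^ 3 - H.orderedTriangles := by
  have h1 := sum_degree_sq_eq_of_trace h
  have h2 := h 3
  rw [trace_lapMatrix_cube, trace_lapMatrix_cube] at h2
  have h3 : ∑ x, ((G.degree x : ℤ) ^ 3 + 3 * (G.degree x : ℤ) ^ 2) - G.orderedTriangles =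
      ∑ x, ((H.degree x : ℤ) ^ 3 + 3 * (H.degree x : ℤ) ^ 2) - H.orderedTriangles := by
    exact_mod_cast h2
  simp only [sum_add_distrib, ← mul_sum] at h3
  linarith

/-- The largest Laplacian eigenvalue exceeds every degree by at least one. -/
theorem degree_add_one_lt_of_lapForm_lt {c : ℝ}
    (h : ∀ x : V → ℝ, x ≠ 0 → G.lapForm x < 2 * c * ∑ i, x i ^ 2) {a : V} (ha : 0 < G.degree a) :
    (G.degree a : ℝ) + 1 < c := by
  set d : ℝ := (G.degree a : ℝ) with hd
  have hd0 : 0 < d := Nat.cast_pos.2 ha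
  -- The top eigenvector of the star at `a`, with eigenvalue `d + 1`; edges of `G` outside the star
  -- only increase the form.
  let x : V → ℝ := fun i => if i = a then d else if G.Adj a i then -1 else 0
  have hxa : x a = d := by simp [x]
  have hxn : ∀ i, G.Adj a i → x i = -1 := fun i hi => by simp [x, hi, hi.ne']
  have hx0 : x ≠ 0 := fun h0 => hd0.ne' (by rw [← hxa, h0]; rfl)
  have hdsum : d = ∑ j, if G.Adj a j then (1 : ℝ) else 0 := G.degree_eq_sum_if_adj a
  have hnorm : ∑ i, x i ^ 2 = d ^ 2 + d := by
    have : ∀ i, x i ^ 2 = (if i = a then d ^ 2 else 0) + if G.Adj a i then 1 else 0 := fun i => by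
      by_cases hi : i = a
      · subst hi; simp [x]
      · by_cases h2 : G.Adj a i <;> simp [x, hi, h2]
    simp only [this, sum_add_distrib, ← hdsum]
    simp
  have hrow : ∀ j, (if G.Adj a j then (x a - x j) ^ 2 else 0) =
      (d + 1) ^ 2 * if G.Adj a j then (1 : ℝ) else 0 := fun j => by
    split_ifs with hj
    · rw [hxa, hxn j hj]; ring
    · simp
  have hlow : 2 * (d * (d + 1) ^ 2) ≤ G.lapForm x := by
    have h1 : ∀ i, (if i = a then d * (d + 1) ^ 2 else 0) +
        ((d + 1) ^ 2 * if G.Adj a i then (1 : ℝ) else 0) ≤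
        ∑ j, if G.Adj i j then (x i - x j) ^ 2 else 0 := fun i => by
      by_cases hi : i = a
      · subst hi
        simp only [hrow, ← mul_sum, ← hdsum]
        simp [mul_comm]
      · rw [if_neg hi, zero_add, ← hrow]
        refine le_trans (le_of_eq ?_) (single_le_sum (fun j _ => ?_) (mem_univ a))
        · simp only [G.adj_comm a i]
          split_ifs <;> ring
        · split_ifs <;> positivity
    refine le_trans (le_of_eq ?_) (sum_le_sum fun i _ => h1 i)
    rw [sum_add_distrib, ← mul_sum, ← hdsum]
    simp
    ring
  have := h x hx0
  rw [hnorm] at this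
  have h2 : 0 < (2 * d * (d + 1)) * (c - (d + 1)) := by linarith
  have h3 := (mul_pos_iff_of_pos_left (by positivity)).1 h2
  linarith

theorem lapForm_single (a : V) : G.lapForm (Pi.single a 1) = 2 * G.degree a := by
  rw [lapForm_eq]
  simp [lapMatrix, degMatrix]

/-- If all but one of the Laplacian eigenvalues are at least two, then so are the degrees. -/
theorem two_le_degree_of_le_lapForm {f : (V → ℝ) →ₗ[ℝ] ℝ}
    (h : ∀ x, f x = 0 → 4 * ∑ i, x i ^ 2 ≤ G.lapForm x) (hV : 3 ≤ Fintype.card V) (a : V) :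
    2 ≤ G.degree a := by
  by_contra! hlt
  -- Constants cost nothing in the form but add to the norm, so a vertex of degree at most 1 would
  -- violate the bound on this plane once there are at least three vertices.
  obtain ⟨c, hc, hfc⟩ := f.exists_sum_smul_map_eq_zero (k := 2) (by simp) ![1, Pi.single a 1]
  rw [Fin.sum_univ_two] at hfc
  have h0 := h _ hfc
  have h1 : G.lapForm (c 0 • ![1, Pi.single a 1] 0 + c 1 • ![1, Pi.single a 1] 1 : V → ℝ) =
      c 1 ^ 2 * (2 * G.degree a) := by
    rw [← lapForm_single, lapForm, lapForm, mul_sum]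
    refine sum_congr rfl fun i _ => ?_
    rw [mul_sum]
    refine sum_congr rfl fun j _ => ?_
    split_ifs
    · simp; ring
    · simp
  have h2 : ∑ i, (c 0 • ![1, Pi.single a 1] 0 + c 1 • ![1, Pi.single a 1] 1 : V → ℝ) i ^ 2 =
      Fintype.card V * c 0 ^ 2 + 2 * c 0 * c 1 + c 1 ^ 2 := by
    have : ∀ i, (c 0 • ![1, Pi.single a 1] 0 + c 1 • ![1, Pi.single a 1] 1 : V → ℝ) i ^ 2 =
        c 0 ^ 2 + if i = a then 2 * c 0 * c 1 + c 1 ^ 2 else 0 := fun i => by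
      by_cases hi : i = a
      · subst hi; simp; ring
      · simp [hi]
    simp only [this, sum_add_distrib]
    simp
    ring
  rw [h1, h2] at h0
  have hd : (G.degree a : ℝ) ≤ 1 := by exact_mod_cast Nat.lt_succ_iff.1 hlt
  have hn : (3 : ℝ) ≤ Fintype.card V := by exact_mod_cast hV
  have h3 : 2 * (3 * c 0 ^ 2 + 2 * c 0 * c 1 + c 1 ^ 2) ≤ c 1 ^ 2 := by
    nlinarith [sq_nonneg (c 0), sq_nonneg (c 1)]
  have h4 : (c 1 + 2 * c 0) ^ 2 + 2 * c 0 ^ 2 ≤ 0 := by linarith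
  have h5 : c 0 = 0 := by nlinarith [sq_nonneg (c 0), sq_nonneg (c 1 + 2 * c 0)]
  have h6 : c 1 = 0 := by rw [h5] at h4; nlinarith
  exact hc (funext fun i => by fin_cases i <;> simp [h5, h6])

/-- Sylvester's criterion for the symmetric matrix with diagonal `e₁, e₂, e₃` and all other entries
`-1`: its leading minors are `e₁`, `e₁ * e₂ - 1` and `e₁ * e₂ * e₃ - e₁ - e₂ - e₃ - 2`. -/
theorem eq_zero_of_ternary_form_nonpos {e₁ e₂ e₃ x y z : ℝ} (h₁ : 1 ≤ e₁) (h₂ : 1 < e₁ * e₂)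
    (h : e₁ + e₂ + e₃ + 2 < e₁ * e₂ * e₃)
    (hle : e₁ * x ^ 2 + e₂ * y ^ 2 + e₃ * z ^ 2 - 2 * x * y - 2 * x * z - 2 * y * z ≤ 0) :
    x = 0 ∧ y = 0 ∧ z = 0 := by
  have hm : 0 < e₁ * e₂ - 1 := by linarith
  have key : (e₁ * e₂ - 1) * (e₁ * x - y - z) ^ 2 + ((e₁ * e₂ - 1) * y - (e₁ + 1) * z) ^ 2 +
      e₁ * (e₁ * e₂ * e₃ - e₁ - e₂ - e₃ - 2) * z ^ 2 = (e₁ * e₂ - 1) * e₁ *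
      (e₁ * x ^ 2 + e₂ * y ^ 2 + e₃ * z ^ 2 - 2 * x * y - 2 * x * z - 2 * y * z) := by ring
  have hneg := mul_nonpos_of_nonneg_of_nonpos (a := (e₁ * e₂ - 1) * e₁) (by positivity) hle
  rw [← key] at hneg
  have hk : 0 < e₁ * (e₁ * e₂ * e₃ - e₁ - e₂ - e₃ - 2) := mul_pos (by linarith) (by linarith)
  have n1 : 0 ≤ (e₁ * e₂ - 1) * (e₁ * x - y - z) ^ 2 := by positivity
  have n2 : 0 ≤ ((e₁ * e₂ - 1) * y - (e₁ + 1) * z) ^ 2 := by positivity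
  have n3 : 0 ≤ e₁ * (e₁ * e₂ * e₃ - e₁ - e₂ - e₃ - 2) * z ^ 2 := by positivity
  have z0 : z = 0 := by
    have : e₁ * (e₁ * e₂ * e₃ - e₁ - e₂ - e₃ - 2) * z ^ 2 = 0 := by linarith
    simpa [hk.ne'] using this
  have y0 : y = 0 := by
    have : ((e₁ * e₂ - 1) * y - (e₁ + 1) * z) ^ 2 = 0 := by linarith
    simpa [hm.ne', z0] using this
  have x0 : x = 0 := by
    have : (e₁ * e₂ - 1) * (e₁ * x - y - z) ^ 2 = 0 := by linarith
    have h1 : e₁ ≠ 0 := by linarith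
    simpa [hm.ne', z0, y0, h1] using this
  exact ⟨x0, y0, z0⟩

/-- If at most two Laplacian eigenvalues exceed two, then three vertices cannot all have a large
degree. -/
theorem degree_mul_le_of_lapForm_le {f : (V → ℝ) →ₗ[ℝ] ℝ × ℝ}
    (h : ∀ x, f x = 0 → G.lapForm x ≤ 4 * ∑ i, x i ^ 2) {a b c : V} (hab : a ≠ b) (hac : a ≠ c)
    (hbc : b ≠ c) {e₁ e₂ e₃ : ℕ} (h₁ : 1 ≤ e₁) (h₂ : 1 ≤ e₂)
    (ha : G.degree a = e₁ + 2) (hb : G.degree b = e₂ + 2) (hc : G.degree c = e₃ + 2) :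
    e₁ * e₂ * e₃ ≤ e₁ + e₂ + e₃ + 2 := by
  by_contra! hlt
  obtain ⟨k, hk, hfk⟩ := f.exists_sum_smul_map_eq_zero (k := 3) (by simp)
    ![Pi.single a 1, Pi.single b 1, Pi.single c 1]
  have h0 := h _ hfk
  have hnorm : ∑ i, (∑ j, k j • ![Pi.single a 1, Pi.single b 1, Pi.single c 1] j : V → ℝ) i ^ 2 =
      k 0 ^ 2 + k 1 ^ 2 + k 2 ^ 2 := by
    have : ∀ i, (∑ j, k j • ![Pi.single a 1, Pi.single b 1, Pi.single c 1] j : V → ℝ) i ^ 2 =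
        (if i = a then k 0 ^ 2 else 0) + (if i = b then k 1 ^ 2 else 0) +
          (if i = c then k 2 ^ 2 else 0) := fun i => by
      rw [Fin.sum_univ_three]
      by_cases i1 : i = a
      · subst i1; simp [hab, hac]
      · by_cases i2 : i = b
        · subst i2; simp [hab.symm, hbc]
        · by_cases i3 : i = c
          · subst i3; simp [hac.symm, hbc.symm]
          · simp [i1, i2, i3]
    simp only [this, sum_add_distrib]
    simp
  have hform : G.lapForm (∑ j, k j • ![Pi.single a 1, Pi.single b 1, Pi.single c 1] j) =
      2 * (k 0 ^ 2 * G.degree a + k 1 ^ 2 * G.degree b + k 2 ^ 2 * G.degree c -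
        2 * k 0 * k 1 * (if G.Adj a b then 1 else 0) -
        2 * k 0 * k 2 * (if G.Adj a c then 1 else 0) -
        2 * k 1 * k 2 * (if G.Adj b c then 1 else 0)) := by
    rw [lapForm_eq, Fin.sum_univ_three]
    simp [lapMatrix, degMatrix, mulVec_add, mulVec_smul, hab, hac, hbc, hab.symm, hac.symm,
      hbc.symm, G.adj_comm b a, G.adj_comm c a, G.adj_comm c b]
    split_ifs <;> ring
  rw [hnorm, hform, ha, hb, hc] at h0
  push_cast at h0
  -- Passing to absolute values reduces every adjacency pattern and sign choice to the worst case,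
  -- three mutually adjacent vertices.
  have hprod : ∀ (P : Prop) [Decidable P] (s t : ℝ),
      s * t * (if P then 1 else 0) ≤ |s| * |t| := fun P _ s t => by
    split_ifs
    · rw [mul_one, ← abs_mul]; exact le_abs_self _
    · rw [mul_zero]; positivity
  have p1 := hprod (G.Adj a b) (k 0) (k 1)
  have p2 := hprod (G.Adj a c) (k 0) (k 2)
  have p3 := hprod (G.Adj b c) (k 1) (k 2)
  have hlt' : (e₁ + e₂ + e₃ + 2 : ℝ) < e₁ * e₂ * e₃ := by exact_mod_cast hlt
  have h12 : 1 < e₁ * e₂ := by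
    by_contra! hle
    have : e₁ * e₂ * e₃ ≤ 1 * e₃ := Nat.mul_le_mul_right _ hle
    omega
  obtain ⟨x0, y0, z0⟩ := eq_zero_of_ternary_form_nonpos (e₁ := e₁) (e₂ := e₂) (e₃ := e₃)
    (x := |k 0|) (y := |k 1|) (z := |k 2|) (by exact_mod_cast h₁) (by exact_mod_cast h12) hlt'
    (by simp only [sq_abs]; linarith)
  rw [abs_eq_zero] at x0 y0 z0
  exact hk (funext fun i => by fin_cases i <;> simp [x0, y0, z0])

end SimpleGraph
end lapForm

/-! ### Arithmetic of the degree sequence -/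

/-- The product bound forces `e₃ ≤ 2` and `e₂ ≤ 3`. Then `hup` has `2 * N ^ 2` on the left against
at most about `N ^ 2` on the right, since `e₁ < N`; this bounds `N` and leaves finitely many cases.
-/
theorem no_three_large {N e₁ e₂ e₃ : ℤ} (h₁ : e₁ + 1 ≤ N) (h₂ : e₂ ≤ e₁) (h₃ : e₃ ≤ e₂)
    (h₀ : 1 ≤ e₃) (hprod : e₁ * e₂ * e₃ ≤ e₁ + e₂ + e₃ + 2)
    (hlow : e₁ * (e₁ + 1) + e₂ * (e₂ + 1) + e₃ * (e₃ + 1) ≤ 2 * (N * (N - 1)))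
    (hup : 2 * (N * (N - 1)) ≤ e₁ * (e₁ + 1) + e₂ * (e₂ + 1) +
      e₃ * (3 * N - 1 - (e₁ + 1) - (e₂ + 1))) : False := by
  have h12 : e₂ * e₂ ≤ e₁ * e₂ := by nlinarith
  have e3 : e₃ ≤ 2 := by
    by_contra! hc
    nlinarith [mul_nonneg (by linarith : 0 ≤ e₂ - 3) (by linarith : 0 ≤ e₁ - 3),
      mul_nonneg (by nlinarith : 0 ≤ e₁ * e₂) (by linarith : 0 ≤ e₃ - 3)]
  have e2 : e₂ ≤ 3 := by
    by_contra! hc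
    nlinarith [mul_nonneg (by linarith : 0 ≤ e₂ - 4) (by linarith : 0 ≤ e₁ - 4),
      mul_nonneg (by nlinarith : 0 ≤ e₁ * e₂) (by linarith : 0 ≤ e₃ - 1)]
  have hN1 : N ≤ 6 := by
    interval_cases e₃ <;> interval_cases e₂ <;> nlinarith
  have : 1 ≤ e₁ := by linarith
  have : e₁ ≤ 5 := by linarith
  interval_cases e₃ <;> interval_cases e₂ <;> interval_cases e₁ <;>
    first | omega | (interval_cases N <;> omega)

/-- Vertices of large degree: a numerical criterion. -/
theorem exists_two_large_of_sums {V : Type*} [Fintype V] [DecidableEq V] {d : V → ℕ} {N : ℤ}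
    (hN : 2 ≤ N) (hpos : ∀ x, 1 ≤ d x) (hmax : ∀ x, (d x : ℤ) ≤ N + 1)
    (h1 : ∑ x, ((d x : ℤ) - 1) ≤ 3 * N - 1)
    (h2 : ∑ x, ((d x : ℤ) - 1) * (d x - 2) = 2 * (N * (N - 1)))
    (h3 : ∀ a b c, a ≠ b → a ≠ c → b ≠ c → ∀ e₁ e₂ e₃ : ℕ, 1 ≤ e₁ → 1 ≤ e₂ → 1 ≤ e₃ →
      d a = e₁ + 2 → d b = e₂ + 2 → d c = e₃ + 2 → e₁ * e₂ * e₃ ≤ e₁ + e₂ + e₃ + 2) :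
    ∃ a b, a ≠ b ∧ (d a : ℤ) = N + 1 ∧ (d b : ℤ) = N + 1 ∧ ∀ x, x ≠ a → x ≠ b → d x ≤ 2 := by
  have hw : ∀ x, 0 ≤ ((d x : ℤ) - 1) * (d x - 2) := fun x => by
    have := hpos x
    rcases this.eq_or_lt with h | h
    · rw [← h]; norm_num
    · have : (2 : ℤ) ≤ d x := by exact_mod_cast h
      nlinarith
  have hwN : ∀ x, ((d x : ℤ) - 1) * (d x - 2) ≤ N * (N - 1) := fun x => by
    have h1 := hmax x
    have h2 : (1 : ℤ) ≤ d x := by exact_mod_cast hpos x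
    nlinarith
  have hNN : 0 < N * (N - 1) := by nlinarith
  have hne : (univ : Finset V).Nonempty := by
    rw [nonempty_iff_ne_empty]
    rintro h
    rw [h, sum_empty] at h2
    linarith
  obtain ⟨a, -, ha⟩ := exists_max_image univ d hne
  have s2 := add_sum_erase univ (fun x => ((d x : ℤ) - 1) * (d x - 2)) (mem_univ a)
  have s1 := add_sum_erase univ (fun x => ((d x : ℤ) - 1)) (mem_univ a)
  have hne2 : (univ.erase a).Nonempty := by
    rw [nonempty_iff_ne_empty]
    rintro h
    rw [h, sum_empty] at s2
    have := hwN a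
    linarith
  obtain ⟨b, hb0, hb⟩ := exists_max_image (univ.erase a) d hne2
  have hba : b ≠ a := ne_of_mem_erase hb0
  have t2 := add_sum_erase (univ.erase a) (fun x => ((d x : ℤ) - 1) * (d x - 2)) hb0
  have t1 := add_sum_erase (univ.erase a) (fun x => ((d x : ℤ) - 1)) hb0
  -- The weight `(d - 1) * (d - 2)` vanishes at degrees 1 and 2 and is at most `N * (N - 1)`. If
  -- only `a` and `b` carry weight, the total forces both to attain the maximum.
  by_cases hsmall : ∀ x, x ≠ a → x ≠ b → d x ≤ 2
  · have hz : ∑ x ∈ (univ.erase a).erase b, ((d x : ℤ) - 1) * (d x - 2) = 0 := by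
      refine sum_eq_zero fun x hx => ?_
      simp only [mem_erase, mem_univ, and_true] at hx
      have h1 := hsmall x hx.2 hx.1
      have h2 := hpos x
      interval_cases d x <;> norm_num
    have heq : ∀ x, ((d x : ℤ) - 1) * (d x - 2) = N * (N - 1) → (d x : ℤ) = N + 1 := fun x hx => by
      have h1 := hmax x
      have h2 : (1 : ℤ) ≤ d x := by exact_mod_cast hpos x
      by_contra hne
      have : (d x : ℤ) ≤ N := by omega
      nlinarith
    have wa := hwN a
    have wb := hwN b
    exact ⟨a, b, hba.symm, heq a (by linarith), heq b (by linarith), hsmall⟩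
  · exfalso
    push Not at hsmall
    obtain ⟨c', hc1, hc2, hc3⟩ := hsmall
    have hc' : c' ∈ (univ.erase a).erase b := by simp [hc1, hc2]
    obtain ⟨c, hc0, hc⟩ := exists_max_image ((univ.erase a).erase b) d ⟨c', hc'⟩
    have u2 := add_sum_erase ((univ.erase a).erase b) (fun x => ((d x : ℤ) - 1) * (d x - 2)) hc0
    have hcc := hc c' hc'
    have hcb : c ≠ b := ne_of_mem_erase hc0
    have hca : c ≠ a := ne_of_mem_erase (mem_of_mem_erase hc0)
    have dcb : d c ≤ d b := hb c (mem_of_mem_erase hc0)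
    have dba : d b ≤ d a := ha b (mem_univ b)
    obtain ⟨e₁, he₁⟩ : ∃ e, d a = e + 2 := ⟨d a - 2, by omega⟩
    obtain ⟨e₂, he₂⟩ : ∃ e, d b = e + 2 := ⟨d b - 2, by omega⟩
    obtain ⟨e₃, he₃⟩ : ∃ e, d c = e + 2 := ⟨d c - 2, by omega⟩
    have hp := h3 a b c hba.symm hca.symm hcb.symm e₁ e₂ e₃ (by omega) (by omega) (by omega)
      he₁ he₂ he₃
    have hrest : 0 ≤ ∑ x ∈ ((univ.erase a).erase b).erase c, ((d x : ℤ) - 1) * (d x - 2) :=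
      sum_nonneg fun x _ => hw x
    -- Outside `a` and `b` the largest degree is `e₃ + 2`, so the quadratic weight is at most `e₃`
    -- times the linear one, whose total is known.
    have hle : ∑ x ∈ (univ.erase a).erase b, ((d x : ℤ) - 1) * (d x - 2) ≤
        e₃ * ∑ x ∈ (univ.erase a).erase b, ((d x : ℤ) - 1) := by
      rw [mul_sum]
      refine sum_le_sum fun x hx => ?_
      have h1 : (1 : ℤ) ≤ d x := by exact_mod_cast hpos x
      have h2 : (d x : ℤ) ≤ e₃ + 2 := by exact_mod_cast he₃ ▸ hc x hx
      nlinarith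
    have hmaxa := hmax a
    simp only [he₁, he₂, he₃] at s1 s2 t1 t2 u2 hmaxa
    push_cast at s1 s2 t1 t2 u2 hmaxa
    have he3 : (0 : ℤ) ≤ e₃ := by positivity
    have hmul : (e₃ : ℤ) * ∑ x ∈ (univ.erase a).erase b, ((d x : ℤ) - 1) ≤
        e₃ * (3 * N - 1 - (e₁ + 1) - (e₂ + 1)) := mul_le_mul_of_nonneg_left (by linarith) he3
    refine no_three_large (N := N) (e₁ := e₁) (e₂ := e₂) (e₃ := e₃) (by linarith) ?_ ?_ ?_ ?_ ?_ ?_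
    · omega
    · omega
    · omega
    · exact_mod_cast hp
    · linarith
    · linarith

/-! ### Reconstructing the graph from its degrees and triangles -/

section
variable {V : Type*} [Fintype V] [DecidableEq V] {H : SimpleGraph V} [DecidableRel H.Adj]

/-- The other vertices split into those seeing only `a`, only `b`, or both. The two degrees and the
vertex count determine the class sizes as `p`, `p`, `q`. -/
theorem nonempty_iso_binaryStar' {p q : ℕ} {a b : V} (hab : H.Adj a b)
    (ha : H.degree a = p + q + 1) (hb : H.degree b = p + q + 1)
    (hV : Fintype.card V = 2 * p + q + 2)
    (h : ∀ x, x ≠ a → x ≠ b → (∀ y, H.Adj x y → y = a ∨ y = b) ∧ ∃ y, H.Adj x y) :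
    Nonempty (binaryStar' p q p ≃g H) := by
  set A : Finset V := {x | x ≠ a ∧ x ≠ b ∧ H.Adj a x ∧ ¬ H.Adj b x} with hA
  set B : Finset V := {x | x ≠ a ∧ x ≠ b ∧ H.Adj b x ∧ ¬ H.Adj a x} with hB
  set C : Finset V := {x | x ≠ a ∧ x ≠ b ∧ H.Adj a x ∧ H.Adj b x} with hC
  have dAC : Disjoint A C := disjoint_left.2 fun x h1 h2 => by simp_all
  have dBC : Disjoint B C := disjoint_left.2 fun x h1 h2 => by simp_all
  have dAB : Disjoint A (B ∪ C) := disjoint_left.2 fun x h1 h2 => by simp_all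
  have na : H.neighborFinset a = insert b (A ∪ C) := by
    ext x
    have := fun h : H.Adj a x => h.ne'
    by_cases hx : x = b
    · simp [hx, hab]
    · simp only [SimpleGraph.mem_neighborFinset, mem_insert, mem_union, hA, hC, mem_filter,
        mem_univ, true_and, hx]
      tauto
  have nb : H.neighborFinset b = insert a (B ∪ C) := by
    ext x
    have := fun h : H.Adj b x => h.ne'
    by_cases hx : x = a
    · simp [hx, hab.symm]
    · simp only [SimpleGraph.mem_neighborFinset, mem_insert, mem_union, hB, hC, mem_filter,
        mem_univ, true_and, hx]
      tauto
  have nu : (univ : Finset V) = insert a (insert b (A ∪ (B ∪ C))) := by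
    ext x
    simp only [mem_univ, true_iff, mem_insert, mem_union]
    by_cases hxa : x = a
    · exact Or.inl hxa
    by_cases hxb : x = b
    · exact Or.inr (Or.inl hxb)
    obtain ⟨h1, y, hy⟩ := h x hxa hxb
    have : H.Adj a x ∨ H.Adj b x := by
      rcases h1 y hy with rfl | rfl
      · exact Or.inl hy.symm
      · exact Or.inr hy.symm
    simp only [hA, hB, hC, mem_filter, mem_univ, true_and]
    tauto
  have ca : 1 + (#A + #C) = p + q + 1 := by
    rw [← ha, ← SimpleGraph.card_neighborFinset_eq_degree, na, card_insert_of_notMem (by simp [hA, hC]),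
      card_union_of_disjoint dAC, add_comm]
  have cb : 1 + (#B + #C) = p + q + 1 := by
    rw [← hb, ← SimpleGraph.card_neighborFinset_eq_degree, nb, card_insert_of_notMem (by simp [hB, hC]),
      card_union_of_disjoint dBC, add_comm]
  have cu : 2 + (#A + (#B + #C)) = 2 * p + q + 2 := by
    rw [← hV, ← card_univ, nu, card_insert_of_notMem (by simp [hA, hB, hC, hab.ne]),
      card_insert_of_notMem (by simp [hA, hB, hC]), card_union_of_disjoint dAB,
      card_union_of_disjoint dBC]
    omega
  let eA := (Finset.equivFinOfCardEq (show #A = p by omega)).symm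
  let eB := (Finset.equivFinOfCardEq (show #B = p by omega)).symm
  let eC := (Finset.equivFinOfCardEq (show #C = q by omega)).symm
  have mA : ∀ i, (eA i : V) ≠ a ∧ (eA i : V) ≠ b ∧ H.Adj a (eA i) ∧ ¬ H.Adj b (eA i) := fun i =>
    (mem_filter.1 (eA i).2).2
  have mB : ∀ i, (eB i : V) ≠ a ∧ (eB i : V) ≠ b ∧ H.Adj b (eB i) ∧ ¬ H.Adj a (eB i) := fun i =>
    (mem_filter.1 (eB i).2).2
  have mC : ∀ i, (eC i : V) ≠ a ∧ (eC i : V) ≠ b ∧ H.Adj a (eC i) ∧ H.Adj b (eC i) := fun i =>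
    (mem_filter.1 (eC i).2).2
  let ψ : BinaryStarVertex p q p → V := Sum.elim (fun t => if t then b else a)
    (Sum.elim (fun i => eA i) (Sum.elim (fun i => eC i) (fun i => eB i)))
  have hinr : ∀ x, ψ (.inr x) ≠ a ∧ ψ (.inr x) ≠ b := by
    rintro (i | i | i)
    · exact ⟨(mA i).1, (mA i).2.1⟩
    · exact ⟨(mC i).1, (mC i).2.1⟩
    · exact ⟨(mB i).1, (mB i).2.1⟩
  have hadj : ∀ t x, H.Adj (ψ (.inl t)) (ψ (.inr x)) ↔ (binaryStar' p q p).Adj (.inl t) (.inr x) := by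
    rintro (_ | _) (i | i | i)
    · simpa [binaryStar'_adj_inl_left, ψ] using (mA i).2.2.1
    · simpa [binaryStar'_adj_inl_mid, ψ] using (mC i).2.2.1
    · simpa [binaryStar'_adj_inl_right, ψ] using (mB i).2.2.2
    · simpa [binaryStar'_adj_inl_left, ψ] using (mA i).2.2.2
    · simpa [binaryStar'_adj_inl_mid, ψ] using (mC i).2.2.2
    · simpa [binaryStar'_adj_inl_right, ψ] using (mB i).2.2.1
  have hinj : Function.Injective ψ := by
    have key : ∀ x y, ψ (.inr x) = ψ (.inr y) → x = y := by
      intro x y hxy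
      have k0 := hadj false x
      have k1 := hadj true x
      rw [hxy, hadj] at k0 k1
      rcases x with i | i | i <;> rcases y with j | j | j <;>
        simp only [binaryStar'_adj_inl_left, binaryStar'_adj_inl_mid, binaryStar'_adj_inl_right,
          reduceCtorEq, iff_true, iff_false, not_true_eq_false] at k0 k1
      · exact congrArg _ (eA.injective (Subtype.ext hxy))
      · exact congrArg _ (congrArg _ (eC.injective (Subtype.ext hxy)))
      · exact congrArg _ (congrArg _ (eB.injective (Subtype.ext hxy)))
    rintro (s | x) (t | y) hxy
    · cases s <;> cases t <;> first | rfl | exact absurd hxy hab.ne | exact absurd hxy hab.ne'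
    · cases s
      · exact absurd hxy.symm (hinr y).1
      · exact absurd hxy.symm (hinr y).2
    · cases t
      · exact absurd hxy (hinr x).1
      · exact absurd hxy (hinr x).2
    · rw [key x y hxy]
  have hbij : Function.Bijective ψ := by
    rw [Fintype.bijective_iff_injective_and_card]
    refine ⟨hinj, ?_⟩
    rw [hV]
    simp
    omega
  refine ⟨⟨Equiv.ofBijective ψ hbij, ?_⟩⟩
  rintro (s | x) (t | y)
  · simp only [Equiv.ofBijective_apply, binaryStar'_adj_inl_inl]
    cases s <;> cases t <;> simp [ψ, hab, hab.symm]
  · exact hadj s y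
  · simp only [Equiv.ofBijective_apply]
    rw [SimpleGraph.adj_comm, hadj, SimpleGraph.adj_comm]
  · simp only [Equiv.ofBijective_apply, not_binaryStar'_adj_inr_inr, iff_false]
    intro hxy
    rcases (h _ (hinr x).1 (hinr x).2).1 _ hxy with h1 | h1
    · exact (hinr y).1 h1
    · exact (hinr y).2 h1

end

section

theorem SimpleGraph.eq_of_degree_eq_one {V : Type*} [Fintype V] {H : SimpleGraph V}
    [DecidableRel H.Adj] {x y z : V} (h : H.degree x = 1) (hy : H.Adj x y)
    (hz : H.Adj x z) : y = z := by
  rw [← SimpleGraph.card_neighborFinset_eq_degree, card_eq_one] at h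
  obtain ⟨w, hw⟩ := h
  have h1 : y ∈ H.neighborFinset x := by simpa
  have h2 : z ∈ H.neighborFinset x := by simpa
  rw [hw, mem_singleton] at h1 h2
  rw [h1, h2]

variable {V : Type*} [Fintype V] [DecidableEq V] {H : SimpleGraph V} [DecidableRel H.Adj]

theorem SimpleGraph.adj_of_degree_add_one_eq_card {a x : V} (h : H.degree a + 1 = Fintype.card V)
    (hx : x ≠ a) : H.Adj a x := by
  have h1 : insert a (H.neighborFinset a) = univ := by
    rw [← card_eq_iff_eq_univ, card_insert_of_notMem (by simp), card_neighborFinset_eq_degree, h]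
  have h2 := mem_univ x
  rw [← h1, mem_insert, mem_neighborFinset] at h2
  exact h2.resolve_left hx

theorem SimpleGraph.eq_of_degree_eq_two {x a b y : V} (h : H.degree x = 2) (hab : a ≠ b)
    (ha : H.Adj x a) (hb : H.Adj x b) (hy : H.Adj x y) : y = a ∨ y = b := by
  have h1 : ({a, b} : Finset V) = H.neighborFinset x := by
    refine eq_of_subset_of_card_le ?_ ?_
    · intro z hz
      simp only [mem_insert, mem_singleton] at hz
      rcases hz with rfl | rfl <;> simpa
    · rw [card_neighborFinset_eq_degree, h, card_pair hab]
  have h2 : y ∈ H.neighborFinset x := by simpa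
  rwa [← h1, mem_insert, mem_singleton] at h2

/-- Two dominating vertices, the other vertices having degree two. -/
theorem nonempty_iso_binaryStar'_zero {q : ℕ} (hV : Fintype.card V = q + 2)
    {a b : V} (hab : a ≠ b) (ha : H.degree a = q + 1) (hb : H.degree b = q + 1)
    (h : ∀ x, x ≠ a → x ≠ b → H.degree x = 2) : Nonempty (binaryStar' 0 q 0 ≃g H) := by
  have hA : ∀ x, x ≠ a → H.Adj a x := fun x => H.adj_of_degree_add_one_eq_card (by omega)
  have hB : ∀ x, x ≠ b → H.Adj b x := fun x => H.adj_of_degree_add_one_eq_card (by omega)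
  exact nonempty_iso_binaryStar' (hA b hab.symm) (by omega) (by omega) (by omega) fun x hxa hxb =>
    ⟨fun y hy => H.eq_of_degree_eq_two (h x hxa hxb) hab (hA x hxa).symm (hB x hxb).symm hy,
      a, (hA x hxa).symm⟩

/-- If there are as many triangles as vertices of degree two, then these have the two large
vertices as neighbours. -/
theorem SimpleGraph.adj_of_orderedTriangles {q : ℕ} {a b : V} {F : Finset V}
    (hF : ∀ x, x ∈ F ↔ x ≠ a ∧ x ≠ b ∧ H.degree x = 2)
    (h : ∀ x, x ≠ a → x ≠ b → H.degree x = 1 ∨ H.degree x = 2) (hq : #F = q)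
    (ht : H.orderedTriangles = 6 * q) {x : V} (hx : x ∈ F) :
    H.Adj a b ∧ ∀ y, H.Adj x y → y = a ∨ y = b := by
  let f : V → ℤ := fun x => if x ∈ F then 1 else 0
  let t : V → V → V → ℤ := fun x y z => if H.Adj x y ∧ H.Adj y z ∧ H.Adj z x then 1 else 0
  have trot : ∀ x y z, t x y z = t y z x := fun x y z => by
    simp only [t]; congr 1; rw [eq_iff_iff]; tauto
  have hmem : ∀ x y z, H.Adj x y → H.Adj y z → H.Adj z x → x ≠ a → x ≠ b → x ∈ F := by
    intro x y z hxy hyz hzx hxa hxb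
    refine (hF x).2 ⟨hxa, hxb, (h x hxa hxb).resolve_left fun h1 => ?_⟩
    exact hyz.ne (H.eq_of_degree_eq_one h1 hxy hzx.symm)
  -- Every triangle meets `F`: its three vertices cannot all lie in `{a, b}`, and a leaf lies in no
  -- triangle.
  have hnn : ∀ x y z, 0 ≤ t x y z * (f x + f y + f z - 1) := by
    intro x y z
    by_cases hT : H.Adj x y ∧ H.Adj y z ∧ H.Adj z x
    · obtain ⟨hxy, hyz, hzx⟩ := hT
      have hf : ∀ x, 0 ≤ f x := fun x => by simp only [f]; split_ifs <;> norm_num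
      have : 1 ≤ f x + f y + f z := by
        by_cases h1 : x ∈ F
        · have : f x = 1 := if_pos h1
          linarith [hf y, hf z]
        by_cases h2 : y ∈ F
        · have : f y = 1 := if_pos h2
          linarith [hf x, hf z]
        by_cases h3 : z ∈ F
        · have : f z = 1 := if_pos h3
          linarith [hf x, hf y]
        exfalso
        have m1 := hmem x y z hxy hyz hzx
        have m2 := hmem y z x hyz hzx hxy
        have m3 := hmem z x y hzx hxy hyz
        have o1 : x = a ∨ x = b := by by_contra! hc; exact h1 (m1 hc.1 hc.2)
        have o2 : y = a ∨ y = b := by by_contra! hc; exact h2 (m2 hc.1 hc.2)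
        have o3 : z = a ∨ z = b := by by_contra! hc; exact h3 (m3 hc.1 hc.2)
        rcases o1 with e1 | e1 <;> rcases o2 with e2 | e2 <;> rcases o3 with e3 | e3 <;>
          first
          | exact hxy.ne (e1.trans e2.symm)
          | exact hyz.ne (e2.trans e3.symm)
          | exact hzx.ne (e3.trans e1.symm)
      exact mul_nonneg (by simp only [t]; split_ifs <;> norm_num) (by linarith)
    · simp [t, hT]
  have hpair : ∀ x ∈ F, ∃ y z, y ≠ z ∧ H.neighborFinset x = {y, z} := fun x hx => by
    rw [← card_eq_two, card_neighborFinset_eq_degree]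
    exact ((hF x).1 hx).2.2
  have hτ : ∀ x y z, H.neighborFinset x = {y, z} → y ≠ z →
      ∑ u, ∑ w, t x u w = if H.Adj y z then 2 else 0 := by
    intro x y z hN hyz
    have hadj : ∀ u, H.Adj x u ↔ u = y ∨ u = z := fun u => by
      rw [← mem_neighborFinset, hN]; simp
    have hsub : ∀ u w, t x u w = if (u = y ∧ w = z ∨ u = z ∧ w = y) ∧ H.Adj y z then 1 else 0 := by
      intro u w
      simp only [t, H.adj_comm w x, hadj]
      congr 1
      rw [eq_iff_iff]
      constructor
      · rintro ⟨rfl | rfl, h2, rfl | rfl⟩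
        · exact absurd rfl h2.ne
        · exact ⟨Or.inl ⟨rfl, rfl⟩, h2⟩
        · exact ⟨Or.inr ⟨rfl, rfl⟩, h2.symm⟩
        · exact absurd rfl h2.ne
      · rintro ⟨⟨rfl, rfl⟩ | ⟨rfl, rfl⟩, h2⟩
        · exact ⟨Or.inl rfl, h2, Or.inr rfl⟩
        · exact ⟨Or.inr rfl, h2.symm, Or.inl rfl⟩
    simp only [hsub]
    split_ifs with h2
    · have : ∀ u w, (if (u = y ∧ w = z ∨ u = z ∧ w = y) ∧ H.Adj y z then (1 : ℤ) else 0) =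
          (if u = y then if w = z then 1 else 0 else 0) +
          (if u = z then if w = y then 1 else 0 else 0) := fun u w => by
        by_cases u1 : u = y
        · subst u1; simp [hyz, h2]
        · by_cases u2 : u = z
          · subst u2; simp [u1, h2]
          · simp [u1, u2]
      simp only [this, sum_add_distrib]
      simp
    · simp [h2]
  -- A vertex of degree 2 lies in at most one triangle, seen here in its two orientations.
  have hτ2 : ∀ x ∈ F, ∑ u, ∑ w, t x u w ≤ 2 := fun x hx => by
    obtain ⟨y, z, hyz, hN⟩ := hpair x hx
    rw [hτ x y z hN hyz]
    split_ifs <;> norm_num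
  have s1 : ∑ x, ∑ y, ∑ z, t x y z * f x = ∑ x ∈ F, ∑ u, ∑ w, t x u w := by
    simp only [f, mul_ite, mul_one, mul_zero]
    rw [← sum_filter_add_sum_filter_not univ (· ∈ F)]
    rw [show univ.filter (· ∈ F) = F by ext; simp]
    rw [sum_congr rfl (g := fun x => ∑ u, ∑ w, t x u w) fun x hx => by simp [hx]]
    rw [sum_eq_zero (s := univ.filter (· ∉ F)) fun x hx => by
      simp [(mem_filter.1 hx).2], add_zero]
  have s2 : ∑ x, ∑ y, ∑ z, t x y z * f z = ∑ x, ∑ y, ∑ z, t x y z * f x := by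
    rw [sum_congr rfl fun x _ => sum_comm (f := fun y z => t x y z * f z), sum_comm]
    refine sum_congr rfl fun z _ => sum_congr rfl fun x _ => sum_congr rfl fun y _ => ?_
    rw [trot z x y]
  have s3 : ∑ x, ∑ y, ∑ z, t x y z * f y = ∑ x, ∑ y, ∑ z, t x y z * f x := by
    rw [sum_comm]
    refine sum_congr rfl fun y _ => ?_
    rw [sum_comm]
    refine sum_congr rfl fun z _ => sum_congr rfl fun x _ => ?_
    rw [trot x y z]
  have hsum : ∑ x, ∑ y, ∑ z, t x y z * (f x + f y + f z - 1) =
      3 * ∑ x ∈ F, ∑ u, ∑ w, t x u w - 6 * q := by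
    rw [← ht, ← s1]
    simp only [mul_sub, mul_add, mul_one, sum_sub_distrib, sum_add_distrib, s2, s3]
    simp only [orderedTriangles, t]
    ring
  have hle : ∑ x ∈ F, ∑ u, ∑ w, t x u w ≤ 2 * q := by
    refine (sum_le_sum hτ2).trans_eq ?_
    rw [sum_const, hq]
    simp [mul_comm]
  have n1 : ∀ x y, 0 ≤ ∑ z, t x y z * (f x + f y + f z - 1) := fun x y =>
    sum_nonneg fun z _ => hnn x y z
  have n2 : ∀ x, 0 ≤ ∑ y, ∑ z, t x y z * (f x + f y + f z - 1) := fun x =>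
    sum_nonneg fun y _ => n1 x y
  have n3 := sum_nonneg fun x (_ : x ∈ univ) => n2 x
  -- The upper bound `3 * (2 * q) - 6 * q = 0` meets nonnegativity. So each triangle has exactly one
  -- vertex in `F`, and each vertex of `F` lies in a triangle, whose other two vertices must be `a`
  -- and `b`.
  have hzero : ∑ x, ∑ y, ∑ z, t x y z * (f x + f y + f z - 1) = 0 := by linarith
  have heq : ∑ x ∈ F, ∑ u, ∑ w, t x u w = ∑ x ∈ F, 2 := by
    rw [sum_const, hq]
    simp
    linarith
  have hx2 := (sum_eq_sum_iff_of_le hτ2).1 heq x hx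
  obtain ⟨y, z, hyz, hN⟩ := hpair x hx
  rw [hτ x y z hN hyz] at hx2
  have hadj : H.Adj y z := by
    by_contra h0
    simp [h0] at hx2
  have hxy : H.Adj x y := by rw [← mem_neighborFinset, hN]; simp
  have hxz : H.Adj x z := by rw [← mem_neighborFinset, hN]; simp
  have z1 := (sum_eq_zero_iff_of_nonneg fun x _ => n2 x).1 hzero x (mem_univ _)
  have z2 := (sum_eq_zero_iff_of_nonneg fun y _ => n1 x y).1 z1 y (mem_univ _)
  have z3 := (sum_eq_zero_iff_of_nonneg fun z _ => hnn x y z).1 z2 z (mem_univ _)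
  have ht1 : t x y z = 1 := if_pos ⟨hxy, hadj, hxz.symm⟩
  have hfx : f x = 1 := if_pos hx
  have hy : y ∉ F := fun hy => by
    have : f y = 1 := if_pos hy
    have : 0 ≤ f z := by simp only [f]; split_ifs <;> norm_num
    rw [ht1] at z3
    linarith
  have hz : z ∉ F := fun hz => by
    have : f z = 1 := if_pos hz
    have : 0 ≤ f y := by simp only [f]; split_ifs <;> norm_num
    rw [ht1] at z3
    linarith
  have m1 := hmem y z x hadj hxz.symm hxy
  have m2 := hmem z x y hxz.symm hxy hadj
  have hy' : y = a ∨ y = b := by by_contra hc; push Not at hc; exact hy (m1 hc.1 hc.2)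
  have hz' : z = a ∨ z = b := by by_contra hc; push Not at hc; exact hz (m2 hc.1 hc.2)
  constructor
  · rcases hy' with rfl | rfl <;> rcases hz' with rfl | rfl
    · exact absurd rfl hyz
    · exact hadj
    · exact hadj.symm
    · exact absurd rfl hyz
  · intro w hw
    rw [← mem_neighborFinset, hN, mem_insert, mem_singleton] at hw
    rcases hw with rfl | rfl
    · exact hy'
    · exact hz'

theorem nonempty_iso_binaryStar'_of_degree {p q : ℕ} {a b : V} (hab : a ≠ b)
    (hconn : ∀ (S : Set V) (s t : V), s ∈ S → t ∉ S → ∃ i ∈ S, ∃ j ∉ S, H.Adj i j)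
    (ha : H.degree a = p + q + 1) (hb : H.degree b = p + q + 1)
    (hV : Fintype.card V = 2 * p + q + 2)
    (h : ∀ x, x ≠ a → x ≠ b → H.degree x = 1 ∨ H.degree x = 2)
    (h1 : ∑ x, (H.degree x : ℤ) = 4 * (p + q) + 2)
    (h3 : ∑ x, (H.degree x : ℤ) ^ 3 - H.orderedTriangles =
      2 * ((p : ℤ) + q + 1) ^ 3 + 2 * p + 2 ^ 3 * q - 6 * q) :
    Nonempty (binaryStar' p q p ≃g H) := by
  set R := (univ.erase a).erase b
  have hbm : b ∈ univ.erase a := by simp [hab.symm]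
  have hsplit : ∀ g : V → ℤ, ∑ x, g x = g a + (g b + ∑ x ∈ R, g x) := fun g => by
    rw [add_sum_erase (univ.erase a) g hbm, add_sum_erase univ g (mem_univ a)]
  have hR : (#R : ℤ) = 2 * p + q := by
    rw [card_erase_of_mem hbm, card_erase_of_mem (mem_univ a), card_univ, hV]
    push_cast [show 2 * p + q + 2 - 1 - 1 = 2 * p + q by omega]
    ring
  set F := R.filter (fun x => H.degree x = 2) with hFdef
  have hmR : ∀ x, x ∈ R ↔ x ≠ a ∧ x ≠ b := fun x => by simp [R, and_comm]
  have hFm : ∀ x, x ∈ F ↔ x ≠ a ∧ x ≠ b ∧ H.degree x = 2 := fun x => by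
    rw [hFdef, mem_filter, hmR, and_assoc]
  have hFR : ∀ g : ℕ → ℤ, ∑ x ∈ R, g (H.degree x) = #R * g 1 + #F * (g 2 - g 1) := fun g => by
    have : ∀ x ∈ R, g (H.degree x) = g 1 + if H.degree x = 2 then g 2 - g 1 else 0 := by
      intro x hx
      rcases h x ((hmR x).1 hx).1 ((hmR x).1 hx).2 with h | h <;> simp [h]
    rw [sum_congr rfl this, sum_add_distrib, ← sum_filter, sum_const, sum_const]
    simp [hFdef]
  have hF : #F = q := by
    rw [hsplit, hFR (fun n => n), hR, ha, hb] at h1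
    push_cast at h1
    zify
    linarith
  have hT : H.orderedTriangles = 6 * q := by
    rw [hsplit, hFR (fun n => (n : ℤ) ^ 3), hR, ha, hb, hF] at h3
    push_cast at h3
    linarith
  have h2 : ∀ x ∈ F, H.Adj a b ∧ ∀ y, H.Adj x y → y = a ∨ y = b := fun x hx =>
    H.adj_of_orderedTriangles hFm h hF hT hx
  have hleaf : ∀ x, x ≠ a → x ≠ b → ∀ y, H.Adj x y → y = a ∨ y = b := by
    intro x hxa hxb y hxy
    rcases h x hxa hxb with hx | hx
    -- A leaf attached to another leaf would form a component `{x, y}` missing `a`; attached to a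
    -- vertex of `F`, it would have to be `a` or `b`.
    · by_contra! hy
      rcases h y hy.1 hy.2 with hy1 | hy1
      · obtain ⟨i, hi, j, hj, hij⟩ := hconn {x, y} x a (by simp) (by simp [hxa.symm, hy.1.symm])
        rcases hi with rfl | rfl
        · exact hj (Or.inr (H.eq_of_degree_eq_one hx hij hxy))
        · exact hj (Or.inl (H.eq_of_degree_eq_one hy1 hij hxy.symm))
      · have := (h2 y ((hFm y).2 ⟨hy.1, hy.2, hy1⟩)).2 x hxy.symm
        tauto
    · exact (h2 x ((hFm x).2 ⟨hxa, hxb, hx⟩)).2 y hxy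
  have hAB : H.Adj a b := by
    by_cases hFe : F.Nonempty
    · obtain ⟨x, hx⟩ := hFe
      exact (h2 x hx).1
    -- With no vertices of degree 2, the neighbours of `a` are leaves, so its closed neighbourhood
    -- would be a component missing `b`.
    · by_contra hn
      obtain ⟨i, hi, j, hj, hij⟩ := hconn {y | y = a ∨ H.Adj a y} a b (by simp)
        (by simp [hn, hab.symm])
      rcases hi with rfl | hi
      · exact hj (Or.inr hij)
      · have hib : i ≠ b := by rintro rfl; exact hn hi
        have hd := (h i hi.ne' hib).resolve_right fun hd =>
          hFe ⟨i, (hFm i).2 ⟨hi.ne', hib, hd⟩⟩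
        exact hj (Or.inl (H.eq_of_degree_eq_one hd hij hi.symm))
  refine nonempty_iso_binaryStar' hAB ha hb hV fun x hxa hxb => ⟨hleaf x hxa hxb, ?_⟩
  have : 0 < H.degree x := by rcases h x hxa hxb with h | h <;> omega
  exact (H.degree_pos_iff_exists_adj x).1 this

end

/-! ### Degree sequences from power sums -/

section
variable {V : Type*} [Fintype V] [DecidableEq V] {H : SimpleGraph V} [DecidableRel H.Adj]

/-- The degrees determine `B'(0,q,0)` if the degrees, for `q` positive, are at least two. -/
theorem nonempty_iso_binaryStar'_zero_of_sums {q : ℕ} (hV : Fintype.card V = q + 2)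
    (hmax : ∀ x, H.degree x ≤ q + 1) (hpos : ∀ x, 1 ≤ H.degree x)
    (hmin : 1 ≤ q → ∀ x, 2 ≤ H.degree x)
    (h1 : ∑ x, (H.degree x : ℤ) = 4 * q + 2)
    (h2 : ∑ x, (H.degree x : ℤ) ^ 2 = 2 * ((q : ℤ) + 1) ^ 2 + 4 * q) :
    Nonempty (binaryStar' 0 q 0 ≃g H) := by
  rcases Nat.lt_or_ge q 2 with hq | hq
  · have hd : ∀ x, H.degree x = q + 1 := fun x => by
      have h1 := hmax x
      have h2 := hpos x
      interval_cases q
      · omega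
      · have := hmin le_rfl x
        omega
    obtain ⟨a, b, hab⟩ := Fintype.exists_pair_of_one_lt_card (α := V) (by omega)
    refine nonempty_iso_binaryStar'_zero hV hab (hd a) (hd b) fun x hxa hxb => ?_
    have h3 : #({x, a, b} : Finset V) = 3 := card_eq_three.2 ⟨x, a, b, hxa, hxb, hab, rfl⟩
    have h4 := card_le_univ ({x, a, b} : Finset V)
    rw [hd x]
    omega
  · have hmin' := hmin (by omega)
    have hq' : (2 : ℤ) ≤ q := by exact_mod_cast hq
    have hcast : ∀ x, (2 : ℤ) ≤ H.degree x ∧ (H.degree x : ℤ) ≤ q + 1 := fun x =>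
      ⟨by exact_mod_cast hmin' x, by exact_mod_cast hmax x⟩
    -- All degrees lie in `[2, q + 1]`, so a vanishing sum of these nonnegative products puts each
    -- degree at an endpoint.
    have hsum : ∑ x, ((H.degree x : ℤ) - 2) * (q + 1 - H.degree x) = 0 := by
      have : ∀ x, ((H.degree x : ℤ) - 2) * (q + 1 - H.degree x) =
          (q + 3) * H.degree x - (H.degree x : ℤ) ^ 2 - 2 * (q + 1) := fun x => by ring
      simp only [this, sum_sub_distrib, ← mul_sum, h1, h2, sum_const, card_univ, hV]
      simp
      ring
    have hall : ∀ x, H.degree x = 2 ∨ H.degree x = q + 1 := fun x => by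
      have h0 := (sum_eq_zero_iff_of_nonneg fun x _ => mul_nonneg
        (by linarith [(hcast x).1]) (by linarith [(hcast x).2])).1 hsum x (mem_univ x)
      rcases mul_eq_zero.1 h0 with h | h
      · exact Or.inl (by omega)
      · exact Or.inr (by omega)
    have hcard : #{x | H.degree x = q + 1} = 2 := by
      have h3 : ∀ x, (H.degree x : ℤ) = 2 + if H.degree x = q + 1 then (q : ℤ) - 1 else 0 := by
        intro x
        split_ifs with h
        · rw [h]; push_cast; ring
        · rw [(hall x).resolve_right h]; norm_num
      rw [sum_congr rfl fun x _ => h3 x, sum_add_distrib, ← sum_filter, sum_const, sum_const,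
        card_univ, hV] at h1
      simp only [nsmul_eq_mul] at h1
      push_cast at h1
      have h4 : (#{x | H.degree x = q + 1} - 2 : ℤ) * (q - 1) = 0 := by linarith
      rcases mul_eq_zero.1 h4 with h | h
      · omega
      · omega
    obtain ⟨a, b, hab, hF⟩ := card_eq_two.1 hcard
    have hm : ∀ x, H.degree x = q + 1 ↔ x = a ∨ x = b := fun x => by
      have : x ∈ ({x | H.degree x = q + 1} : Finset V) ↔ x ∈ ({a, b} : Finset V) := by rw [hF]
      simpa using this
    exact nonempty_iso_binaryStar'_zero hV hab ((hm a).2 (Or.inl rfl)) ((hm b).2 (Or.inr rfl))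
      fun x hxa hxb => (hall x).resolve_right fun h => by
        rcases (hm x).1 h with h | h
        · exact hxa h
        · exact hxb h

theorem exists_two_large_degree {p q : ℕ} (hp : 1 ≤ p) (hV : Fintype.card V = 2 * p + q + 2)
    (hmax : ∀ x, H.degree x ≤ p + q + 1) (hpos : ∀ x, 1 ≤ H.degree x)
    (h1 : ∑ x, (H.degree x : ℤ) = 4 * (p + q) + 2)
    (h2 : ∑ x, (H.degree x : ℤ) ^ 2 = 2 * ((p : ℤ) + q + 1) ^ 2 + 2 * p + 4 * q)
    (h3 : ∀ a b c, a ≠ b → a ≠ c → b ≠ c → ∀ e₁ e₂ e₃ : ℕ, 1 ≤ e₁ → 1 ≤ e₂ → 1 ≤ e₃ →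
      H.degree a = e₁ + 2 → H.degree b = e₂ + 2 → H.degree c = e₃ + 2 →
      e₁ * e₂ * e₃ ≤ e₁ + e₂ + e₃ + 2) :
    ∃ a b, a ≠ b ∧ H.degree a = p + q + 1 ∧ H.degree b = p + q + 1 ∧
      ∀ x, x ≠ a → x ≠ b → H.degree x = 1 ∨ H.degree x = 2 := by
  have hs : ∑ x, ((H.degree x : ℤ) - 1) = 2 * p + 3 * q := by
    rw [sum_sub_distrib, h1, sum_const, card_univ, hV]
    simp
    ring
  rcases Nat.lt_or_ge (p + q) 2 with hN | hN
  -- Here `N * (N - 1) = 0` and the weights carry no information; the sum of the degrees alone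
  -- settles this case.
  · obtain ⟨rfl, rfl⟩ : p = 1 ∧ q = 0 := by omega
    have hall : ∀ x, H.degree x = 1 ∨ H.degree x = 2 := fun x => by
      have := hmax x
      have := hpos x
      omega
    have hcard : #{x | H.degree x = 2} = 2 := by
      have h4 : ∀ x, (H.degree x : ℤ) - 1 = if H.degree x = 2 then 1 else 0 := fun x => by
        rcases hall x with h | h <;> simp [h]
      rw [sum_congr rfl fun x _ => h4 x] at hs
      simp at hs
      exact_mod_cast hs
    obtain ⟨a, b, hab, hF⟩ := card_eq_two.1 hcard
    have hm : ∀ x, H.degree x = 2 ↔ x = a ∨ x = b := fun x => by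
      have : x ∈ ({x | H.degree x = 2} : Finset V) ↔ x ∈ ({a, b} : Finset V) := by rw [hF]
      simpa using this
    exact ⟨a, b, hab, (hm a).2 (Or.inl rfl), (hm b).2 (Or.inr rfl), fun x _ _ => hall x⟩
  · obtain ⟨a, b, hab, ha, hb, h⟩ := exists_two_large_of_sums (d := fun x => H.degree x)
      (N := (p : ℤ) + q) (by exact_mod_cast hN) hpos (fun x => by exact_mod_cast hmax x)
      -- The bound `2 * p + 3 * q ≤ 3 * N - 1` is where `p ≥ 1` enters.
      (by simp only [hs]; omega) (by
        have : ∀ x, ((H.degree x : ℤ) - 1) * (H.degree x - 2) =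
          (H.degree x : ℤ) ^ 2 - 3 * H.degree x + 2 := fun x => by ring
        simp only [this, sum_add_distrib, sum_sub_distrib, ← mul_sum, h1, h2, sum_const,
          card_univ, hV]
        simp
        ring) h3
    refine ⟨a, b, hab, by exact_mod_cast ha, by exact_mod_cast hb, fun x hxa hxb => ?_⟩
    have := h x hxa hxb
    have := hpos x
    omega

end

/-! ### Assembly -/

theorem nonempty_iso_of_laplacianSpectrum_eq {p q : ℕ} {H : SimpleGraph (BinaryStarVertex p q p)}
    (h : laplacianSpectrum (binaryStar' p q p) = laplacianSpectrum H) :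
    Nonempty (binaryStar' p q p ≃g H) := by
  classical
  obtain ⟨⟨T, hT⟩, htr⟩ := SimpleGraph.exists_isometry_of_spectrum_eq h
  have hT0 : ∀ x, T x = 0 → x = 0 := fun x hx => by
    have h1 := (hT x).2
    rw [hx] at h1
    have h2 : ∑ i, x i ^ 2 = 0 := by rw [← h1]; simp
    funext i
    simpa using (sum_eq_zero_iff_of_nonneg fun i _ => sq_nonneg (x i)).1 h2 i (mem_univ i)
  have hV : Fintype.card (BinaryStarVertex p q p) = 2 * p + q + 2 := by
    simp
    omega
  have h1 : ∑ x, (H.degree x : ℤ) = 4 * (p + q) + 2 := by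
    rw [← SimpleGraph.sum_degree_eq_of_trace htr, binaryStar'_sum_degree fun n => (n : ℤ)]
    push_cast
    ring
  have h2 : ∑ x, (H.degree x : ℤ) ^ 2 = 2 * ((p : ℤ) + q + 1) ^ 2 + 2 * p + 4 * q := by
    rw [← SimpleGraph.sum_degree_sq_eq_of_trace htr, binaryStar'_sum_degree fun n => (n : ℤ) ^ 2]
    push_cast
    ring
  have h3 : ∑ x, (H.degree x : ℤ) ^ 3 - H.orderedTriangles =
      2 * ((p : ℤ) + q + 1) ^ 3 + 2 * p + 2 ^ 3 * q - 6 * q := by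
    rw [← SimpleGraph.sum_degree_cube_eq_of_trace htr,
      binaryStar'_sum_degree fun n => (n : ℤ) ^ 3, SimpleGraph.orderedTriangles,
      binaryStar'_sum_triangles]
    push_cast
    ring
  have hconn : ∀ (S : Set (BinaryStarVertex p q p)) s t, s ∈ S → t ∉ S →
      ∃ i ∈ S, ∃ j ∉ S, H.Adj i j := fun S s t hs ht =>
    -- A null vector of the form of `B'` is constant, so vanishing at one centre kills it.
    SimpleGraph.exists_adj_of_lapForm_ker (f := LinearMap.proj (.inl false) ∘ₗ T)
      (fun x hx hle => hT0 x
        (binaryStar'_eq_zero_of_lapForm_nonpos ((hT x).1.trans_le hle) hx)) S hs ht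
  have hpos : ∀ x, 1 ≤ H.degree x := fun x => by
    obtain ⟨y, hy⟩ := Fintype.exists_ne_of_one_lt_card (by rw [hV]; omega) x
    obtain ⟨i, rfl, j, -, hij⟩ := hconn {x} x y rfl hy
    exact (H.degree_pos_iff_exists_adj _).2 ⟨j, hij⟩
  have hmax : ∀ x, H.degree x ≤ p + q + 1 := fun x => by
    have := SimpleGraph.degree_add_one_lt_of_lapForm_lt (G := H) (c := p + q + 3) (fun x hx => by
      rw [← (hT x).1, ← (hT x).2]
      exact binaryStar'_lapForm_lt _ fun h0 => hx (hT0 x h0)) (hpos x)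
    have : H.degree x + 1 < p + q + 3 := by exact_mod_cast this
    omega
  rcases Nat.eq_zero_or_pos p with rfl | hp
  · refine nonempty_iso_binaryStar'_zero_of_sums (by omega) (fun x => by simpa using hmax x) hpos
      (fun hq => ?_) (by simpa using h1) (by simpa using h2)
    refine SimpleGraph.two_le_degree_of_le_lapForm
      (f := (LinearMap.proj (.inl false) + LinearMap.proj (.inl true)) ∘ₗ T) (fun x hx => ?_)
      (by omega)
    rw [← (hT x).1, ← (hT x).2]
    exact le_binaryStar'_lapForm _ hx
  · obtain ⟨a, b, hab, ha, hb, hd⟩ := exists_two_large_degree hp hV hmax hpos h1 h2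
      fun a b c hab hac hbc e₁ e₂ e₃ he₁ he₂ he₃ ha hb hc =>
        SimpleGraph.degree_mul_le_of_lapForm_le
          (f := (LinearMap.prod (LinearMap.proj (.inl false)) (LinearMap.proj (.inl true))) ∘ₗ T)
          (fun x hx => by
            rw [← (hT x).1, ← (hT x).2]
            exact binaryStar'_lapForm_le _ (congrArg Prod.fst hx) (congrArg Prod.snd hx))
          hab hac hbc he₁ he₂ ha hb hc
    exact nonempty_iso_binaryStar'_of_degree hab hconn ha hb hV hd h1 h3

theorem proposition4p7 (p q : ℕ) : IsDLS.{0, v} (binaryStar' p q p) := by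
  intro W _ H h
  have hcard : Fintype.card W = Fintype.card (BinaryStarVertex p q p) := by
    rw [← laplacianSpectrum_card H, ← laplacianSpectrum_card (binaryStar' p q p)]
    exact congrArg _ (Eq.symm h)
  let φ := SimpleGraph.Iso.map (Fintype.equivOfCardEq hcard) H
  obtain ⟨ψ⟩ := nonempty_iso_of_laplacianSpectrum_eq (Eq.trans h (laplacianSpectrum_iso φ))
  exact ⟨ψ.trans φ.symm⟩
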